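/- Let $n\in\mathbb N_0$. For $d\in\mathbb R$ let $S^d_{\rho,\delta}=S^d_{\rho,\delta}(\mathbb R^n\times\mathbb R^n)$ be the set of $a\in C^\infty(\mathbb R^n\times\mathbb R^n)$ such that for all multiindices $\alpha,\beta$ there is a constant $C_{\alpha,\beta}$ with $$|\partial_\eta^\alpha\partial_x^\beta a(x,\eta)|\le C_{\alpha,\beta}(1+|\eta|)^{d-\rho|\alpha|+\delta|\beta|}\qquad (x,\eta\in\mathbb R^n),$$ and put $S^\infty_{1,1}=\bigcup_{d\in\mathbb R}S^d_{1,1}$ and $S^{-\infty}=\bigcap_{d\in\mathbb R}S^d_{1,0}$. For $b\in S^{-\infty}$ let $\operatorname{OP}(b)\colon\mathcal S'(\mathbb R^n)\to\mathcal D'(\mathbb R^n)$ be the linear map that sends $u$ to the continuous function $$\operatorname{OP}(b)u(x)=\langle \hat u,\ (2\pi)^{-n}e^{i x\cdot\eta}\,b(x,\eta)\rangle,$$ where $\hat u$ is the Fourier transform (with kernel $e^{-ix\cdot\eta}$) and the pairing is in the variable $\eta$. A modulation function is a $\psi\in C_0^\infty(\mathbb R^n)$ that equals $1$ in a neighbourhood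 of the origin. For $a\in S^\infty_{1,1}$ and $m\in\mathbb N_0$ let $a_{\psi,m}(x,\eta)=\psi(2^{-m}D_x)a(x,\eta)\,\psi(2^{-m}\eta)$, where $\psi(2^{-m}D_x)a(\cdot,\eta)=\mathcal F^{-1}_{\xi\to x}\big[\psi(2^{-m}\xi)\,\mathcal F_{x\to\xi}a(\xi,\eta)\big]$; then $a_{\psi,m}\in S^{-\infty}$. For $a\in S^\infty_{1,1}$ the operator $a(x,D)$ defined by vanishing frequency modulation is the linear map from a subspace of $\mathcal S'(\mathbb R^n)$ to $\mathcal D'(\mathbb R^n)$ whose domain consists of the $u\in\mathcal S'(\mathbb R^n)$ for which $\lim_{m\to\infty}\operatorname{OP}(a_{\psi,m})u$ exists in $\mathcal D'(\mathbb R^n)$ for every modulation function $\psi$ and is independent of $\psi$; then $a(x,D)u$ is this limit. Consider the operator assignments $a\mapsto\widetilde{\operatorname{OP}}(a)$ that map each $a\in S^\infty_{1,1}$ to a linear map $\widetilde{\operatorname{OP}}(a)$ from a subspace $D(\widetilde{\operatorname{OP}}(a))$ of $\mathcal S'(\mathbb R^n)$ to $\mathcal D'(\mathbb R^n)$ such that: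 (i) (compatibility with $\operatorname{OP}$ on $S^{-\infty}$) for every $b\in S^{-\infty}$, $D(\widetilde{\operatorname{OP}}(b))=\mathcal S'(\mathbb R^n)$ and $\widetilde{\operatorname{OP}}(b)u=\operatorname{OP}(b)u$ for all $u\in\mathcal S'(\mathbb R^n)$; (ii) (stability under vanishing frequency modulation) for every $b\in S^\infty_{1,1}$, every modulation function $\psi$ and every $u\in D(\widetilde{\operatorname{OP}}(b))$, the values $\widetilde{\operatorname{OP}}(b_{\psi,m})u$ are defined and $$\widetilde{\operatorname{OP}}(b)u=\lim_{m\to\infty}\widetilde{\operatorname{OP}}(b_{\psi,m})u\quad\text{in }\mathcal D'(\mathbb R^n).$$ **Theorem.** The map $a\mapsto a(x,D)$ given by vanishing frequency modulation is one of these assignments. Moreover, for every such assignment $\widetilde{\operatorname{OP}}$ and every $a\in S^\infty_{1,1}$ one has $\widetilde{\operatorname{OP}}(a)\subset a(x,D)$, that is, $D(\widetilde{\operatorname{OP}}(a))\subset D(a(x,D))$ and $\widetilde{\operatorname{OP}}(a)u=a(x,D)u$ for all $u\in D(\widetilde{\operatorname{OP}}(a))$. -/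

import Mathlib

open scoped SchwartzMap Distributions FourierTransform ContDiff Topology
open MeasureTheory Filter

namespace TypeOneOne

/-- The space `ℝⁿ` with its Euclidean norm. -/
abbrev Rn (n : ℕ) := EuclideanSpace ℝ (Fin n)

/-- The space `𝓓'(ℝⁿ)` of complex distributions on `ℝⁿ`. -/
abbrev Dist (n : ℕ) := 𝓓'((⊤ : TopologicalSpace.Opens (Rn n)), ℂ)

/-! ### Symbol classes -/

/-- The symbol class `S^d_{ρ,δ}(ℝⁿ × ℝⁿ)`: the function `a(x, η)` is smooth and every partial
derivative with `|α|` differentiations in `η` and `|β|` differentiations in `x` is at most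
`C (1 + |η|) ^ (d - ρ |α| + δ |β|)`. Here `N = |α| + |β|` is the total number of differentiations,
`s` is the set of those (among the `N`) that are taken in `η`, and `v i` is the direction of the
`i`-th one. -/
def IsSymbol {n : ℕ} (d ρ δ : ℝ) (a : Rn n → Rn n → ℂ) : Prop :=
  ContDiff ℝ ∞ (fun p : Rn n × Rn n => a p.1 p.2) ∧
  ∀ (N : ℕ) (s : Finset (Fin N)), ∃ C : ℝ, ∀ (x η : Rn n) (v : Fin N → Rn n),
    ‖iteratedFDeriv ℝ N (fun p : Rn n × Rn n => a p.1 p.2) (x, η)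
        (fun i => if i ∈ s then (0, v i) else (v i, 0))‖
      ≤ C * (1 + ‖η‖) ^ (d - ρ * (s.card : ℝ) + δ * (sᶜ.card : ℝ)) * ∏ i, ‖v i‖

/-- `S^{-∞} = ⋂_d S^d_{1,0}`. -/
def IsSmoothing {n : ℕ} (b : Rn n → Rn n → ℂ) : Prop := ∀ d : ℝ, IsSymbol d 1 0 b

/-- `S^∞_{1,1} = ⋃_d S^d_{1,1}`. -/
def SymbolOneOne (n : ℕ) := {a : Rn n → Rn n → ℂ // ∃ d : ℝ, IsSymbol d 1 1 a}

/-- All derivatives of a symbol have at most polynomial growth in `η`, uniformly in `x`. -/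
theorem IsSymbol.bound {n : ℕ} {d ρ δ : ℝ} {a : Rn n → Rn n → ℂ} (ha : IsSymbol d ρ δ a) (N : ℕ) :
    ∃ C : ℝ, 0 ≤ C ∧ ∀ p : Rn n × Rn n,
      ‖iteratedFDeriv ℝ N (fun p : Rn n × Rn n => a p.1 p.2) p‖
        ≤ C * (1 + ‖p.2‖) ^ (d + (|ρ| + |δ|) * N) := by
  choose C hC using ha.2 N
  refine ⟨∑ s, |C s|, Finset.sum_nonneg fun _ _ => abs_nonneg _, fun p => ?_⟩
  have h1 : (1 : ℝ) ≤ 1 + ‖p.2‖ := by linarith [norm_nonneg p.2]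
  refine ContinuousMultilinearMap.opNorm_le_bound
    (mul_nonneg (Finset.sum_nonneg fun _ _ => abs_nonneg _) (by positivity)) fun m => ?_
  have hm : m = (fun i => ((0 : Rn n), (m i).2)) + (fun i => ((m i).1, (0 : Rn n))) := by
    ext1 i; simp
  conv_lhs => rw [hm, ContinuousMultilinearMap.map_add_univ]
  refine (norm_sum_le _ _).trans ?_
  rw [Finset.sum_mul, Finset.sum_mul]
  refine Finset.sum_le_sum fun s _ => ?_
  have h2 := hC s p.1 p.2 (fun i => if i ∈ s then (m i).2 else (m i).1)
  have h3 : (fun i => if i ∈ s then ((0 : Rn n), if i ∈ s then (m i).2 else (m i).1)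
      else (if i ∈ s then (m i).2 else (m i).1, (0 : Rn n)))
      = s.piecewise (fun i => ((0 : Rn n), (m i).2)) (fun i => ((m i).1, (0 : Rn n))) := by
    ext1 i
    by_cases hi : i ∈ s <;> simp [Finset.piecewise, hi]
  rw [h3] at h2
  refine h2.trans ?_
  have hs : (s.card : ℝ) ≤ N := by
    exact_mod_cast (Finset.card_le_univ s).trans_eq (Fintype.card_fin N)
  have hs' : (sᶜ.card : ℝ) ≤ N := by
    exact_mod_cast (Finset.card_le_univ sᶜ).trans_eq (Fintype.card_fin N)
  have hexp : d - ρ * (s.card : ℝ) + δ * (sᶜ.card : ℝ) ≤ d + (|ρ| + |δ|) * N := by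
    have e1 : -ρ * (s.card : ℝ) ≤ |ρ| * N :=
      mul_le_mul (neg_le_abs ρ) hs (Nat.cast_nonneg _) (abs_nonneg _)
    have e2 : δ * (sᶜ.card : ℝ) ≤ |δ| * N :=
      mul_le_mul (le_abs_self δ) hs' (Nat.cast_nonneg _) (abs_nonneg _)
    linarith
  have hprod : ∏ i, ‖(if i ∈ s then (m i).2 else (m i).1 : Rn n)‖ ≤ ∏ i, ‖m i‖ := by
    refine Finset.prod_le_prod (fun _ _ => norm_nonneg _) fun i _ => ?_
    split_ifs
    · exact norm_snd_le _
    · exact norm_fst_le _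
  gcongr
  exact le_abs_self _

/-- Derivatives of a symbol in `S^{-∞}` decay rapidly in `η`, uniformly in `x`. -/
theorem IsSmoothing.bound {n : ℕ} {b : Rn n → Rn n → ℂ} (hb : IsSmoothing b) (N K : ℕ) :
    ∃ C : ℝ, 0 ≤ C ∧ ∀ p : Rn n × Rn n,
      (1 + ‖p.2‖) ^ K * ‖iteratedFDeriv ℝ N (fun p : Rn n × Rn n => b p.1 p.2) p‖ ≤ C := by
  obtain ⟨C, hC0, hC⟩ := (hb (-(K : ℝ) - N)).bound N
  refine ⟨C, hC0, fun p => ?_⟩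
  have h1 : (0 : ℝ) < 1 + ‖p.2‖ := by linarith [norm_nonneg p.2]
  have h2 := hC p
  have he : (-(K : ℝ) - N) + (|(1 : ℝ)| + |(0 : ℝ)|) * N = -(K : ℝ) := by simp
  rw [he, Real.rpow_neg h1.le, Real.rpow_natCast] at h2
  calc _ ≤ (1 + ‖p.2‖) ^ K * (C * ((1 + ‖p.2‖) ^ K)⁻¹) := by gcongr
    _ = C := by field_simp

/-- Rapid decay of all derivatives characterises `S^{-∞}`. -/
theorem IsSmoothing.of_bound {n : ℕ} {b : Rn n → Rn n → ℂ}
    (hs : ContDiff ℝ ∞ (fun p : Rn n × Rn n => b p.1 p.2))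
    (hb : ∀ N K : ℕ, ∃ C : ℝ, ∀ p : Rn n × Rn n,
      (1 + ‖p.2‖) ^ K * ‖iteratedFDeriv ℝ N (fun p : Rn n × Rn n => b p.1 p.2) p‖ ≤ C) :
    IsSmoothing b := by
  refine fun d => ⟨hs, fun N s => ?_⟩
  set e : ℝ := d - 1 * (s.card : ℝ) + 0 * (sᶜ.card : ℝ) with he
  obtain ⟨K, hK⟩ := exists_nat_ge (-e)
  obtain ⟨C, hC⟩ := hb N K
  refine ⟨C, fun x η v => ?_⟩
  have h1 : (1 : ℝ) ≤ 1 + ‖η‖ := by linarith [norm_nonneg η]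
  have h0 : (0 : ℝ) < 1 + ‖η‖ := by linarith
  have hC' := hC (x, η)
  simp only at hC'
  have hC0 : 0 ≤ C := le_trans (by positivity) hC'
  have h2 : ‖iteratedFDeriv ℝ N (fun p : Rn n × Rn n => b p.1 p.2) (x, η)‖
      ≤ C * (1 + ‖η‖) ^ e := by
    calc _ ≤ C * ((1 + ‖η‖) ^ K)⁻¹ := by
          rw [← div_eq_mul_inv, le_div_iff₀ (by positivity), mul_comm]; exact hC'
      _ = C * (1 + ‖η‖) ^ (-(K : ℝ)) := by rw [Real.rpow_neg h0.le, Real.rpow_natCast]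
      _ ≤ _ := by gcongr; linarith
  refine (ContinuousMultilinearMap.le_opNorm _ _).trans ?_
  have h3 : ∏ i, ‖(if i ∈ s then (0, v i) else (v i, 0) : Rn n × Rn n)‖ ≤ ∏ i, ‖v i‖ := by
    refine Finset.prod_le_prod (fun _ _ => norm_nonneg _) fun i _ => ?_
    split_ifs <;> simp [Prod.norm_def]
  exact mul_le_mul h2 h3 (Finset.prod_nonneg fun _ _ => norm_nonneg _) (by positivity)

theorem IsSmoothing.exists_isSymbol {n : ℕ} {b : Rn n → Rn n → ℂ} (hb : IsSmoothing b) :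
    ∃ d : ℝ, IsSymbol d 1 1 b := by
  refine ⟨0, (hb 0).1, fun N s => ?_⟩
  obtain ⟨C, hC⟩ := (hb 0).2 N s
  refine ⟨|C|, fun x η v => ?_⟩
  have h1 : (1 : ℝ) ≤ 1 + ‖η‖ := by linarith [norm_nonneg η]
  refine (hC x η v).trans ?_
  gcongr
  · exact le_abs_self C
  · norm_num

noncomputable section

/-! ### The operator `OP(b)` on `𝓢'` for `b ∈ S^{-∞}` -/

theorem iteratedFDeriv_slice {n : ℕ} {H : Rn n × Rn n → ℂ} (hs : ContDiff ℝ ∞ H) (N : ℕ)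
    (x ζ : Rn n) :
    iteratedFDeriv ℝ N (fun ζ => H (x, ζ)) ζ = (iteratedFDeriv ℝ N H (x, ζ)).compContinuousLinearMap
      (fun _ => ContinuousLinearMap.inr ℝ (Rn n) (Rn n)) := by
  have h1 : (fun ζ => H (x, ζ)) =
      (fun p => H ((x, (0 : Rn n)) + p)) ∘ ContinuousLinearMap.inr ℝ (Rn n) (Rn n) := by
    ext1 ζ; simp
  have h2 : ContDiff ℝ ∞ (fun p => H ((x, (0 : Rn n)) + p)) :=
    hs.comp (contDiff_const.add contDiff_id)
  rw [h1, ContinuousLinearMap.iteratedFDeriv_comp_right _ h2 _ (by exact_mod_cast le_top),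
    iteratedFDeriv_comp_add_left]
  simp

/-- A smooth `H(x, ζ)`, all of whose derivatives decay rapidly in `ζ` and are locally bounded in
`x`, gives Schwartz functions `H(x, ·)`. -/
def slice {n : ℕ} (H : Rn n × Rn n → ℂ) (hs : ContDiff ℝ ∞ H)
    (hb : ∀ N K : ℕ, ∃ (C : ℝ) (M : ℕ), ∀ p : Rn n × Rn n,
      (1 + ‖p.2‖) ^ K * ‖iteratedFDeriv ℝ N H p‖ ≤ C * (1 + ‖p.1‖) ^ M)
    (x : Rn n) : 𝓢(Rn n, ℂ) where
  toFun ζ := H (x, ζ)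
  smooth' := hs.comp (contDiff_const.prodMk contDiff_id)
  decay' k N := by
    obtain ⟨C, M, h⟩ := hb N k
    refine ⟨C * (1 + ‖x‖) ^ M, fun ζ => ?_⟩
    refine le_trans ?_ (h (x, ζ))
    have h1 : ‖iteratedFDeriv ℝ N (fun ζ => H (x, ζ)) ζ‖ ≤ ‖iteratedFDeriv ℝ N H (x, ζ)‖ := by
      rw [iteratedFDeriv_slice hs]
      refine (ContinuousMultilinearMap.norm_compContinuousLinearMap_le _ _).trans ?_
      exact mul_le_of_le_one_right (norm_nonneg _) (Finset.prod_le_one (fun _ _ => norm_nonneg _)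
        (fun _ _ => ContinuousLinearMap.norm_inr_le_one ℝ (Rn n) (Rn n)))
    gcongr
    simp

theorem hasTemperateGrowth_cexp (c : ℝ) :
    Function.HasTemperateGrowth (fun r : ℝ => Complex.exp (c * Complex.I * r)) := by
  have h : ∀ N : ℕ, iteratedDeriv N (fun r : ℝ => Complex.exp (c * Complex.I * r)) =
      fun r : ℝ => (c * Complex.I) ^ N * Complex.exp (c * Complex.I * r) := by
    intro N
    induction N with
    | zero => simp
    | succ N ih =>
      rw [iteratedDeriv_succ, ih]
      ext1 r
      have h1 : HasDerivAt (fun r : ℝ => c * Complex.I * (r : ℂ)) (c * Complex.I * 1) r :=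
        (Complex.ofRealCLM.hasDerivAt (x := r)).const_mul _
      rw [(h1.cexp.const_mul ((c * Complex.I) ^ N)).deriv]
      ring
  refine ⟨(contDiff_const.mul Complex.ofRealCLM.contDiff).cexp, fun N => ⟨0, |c| ^ N, fun r => ?_⟩⟩
  rw [norm_iteratedFDeriv_eq_norm_iteratedDeriv, h]
  have : ‖Complex.exp (c * Complex.I * r)‖ = 1 := by
    rw [show (c : ℂ) * Complex.I * r = ((c * r : ℝ) : ℂ) * Complex.I by push_cast; ring]
    exact Complex.norm_exp_ofReal_mul_I _
  simp [this]

theorem continuous_slice {n : ℕ} (H : Rn n × Rn n → ℂ) (hs : ContDiff ℝ ∞ H)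
    (hb : ∀ N K : ℕ, ∃ (C : ℝ) (M : ℕ), ∀ p : Rn n × Rn n,
      (1 + ‖p.2‖) ^ K * ‖iteratedFDeriv ℝ N H p‖ ≤ C * (1 + ‖p.1‖) ^ M) :
    Continuous (slice H hs hb) := by
  rw [continuous_iff_continuousAt]
  intro x₀
  rw [ContinuousAt, (schwartz_withSeminorms ℝ (Rn n) ℂ).tendsto_nhds]
  rintro ⟨k, N⟩ ε hε
  obtain ⟨C, M, h⟩ := hb (N + 1) k
  have hC : 0 ≤ C := by
    have := le_trans (by positivity) (h (0, 0))
    simpa using this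
  set D : ℝ := C * (2 + ‖x₀‖) ^ M with hD
  have hlim : Tendsto (fun x => D * ‖x - x₀‖) (𝓝 x₀) (𝓝 0) := by
    have : Continuous (fun x => D * ‖x - x₀‖) := by fun_prop
    simpa using this.tendsto x₀
  filter_upwards [hlim.eventually_lt_const hε, Metric.ball_mem_nhds x₀ one_pos] with x hx hx1
  refine lt_of_le_of_lt ?_ hx
  refine SchwartzMap.seminorm_le_bound ℝ k N _ (by positivity) fun ζ => ?_
  have hdiff : iteratedFDeriv ℝ N (slice H hs hb x - slice H hs hb x₀ : 𝓢(Rn n, ℂ)) ζ =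
      (iteratedFDeriv ℝ N H (x, ζ) - iteratedFDeriv ℝ N H (x₀, ζ)).compContinuousLinearMap
      (fun _ => ContinuousLinearMap.inr ℝ (Rn n) (Rn n)) := by
    have e : ((slice H hs hb x - slice H hs hb x₀ : 𝓢(Rn n, ℂ)) : Rn n → ℂ) =
      (fun ζ => H (x, ζ)) - (fun ζ => H (x₀, ζ)) := rfl
    rw [e, iteratedFDeriv_sub_apply, iteratedFDeriv_slice hs, iteratedFDeriv_slice hs]
    · rfl
    · exact ((hs.comp (contDiff_const.prodMk contDiff_id)).of_le (by exact_mod_cast le_top)).contDiffAt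
    · exact ((hs.comp (contDiff_const.prodMk contDiff_id)).of_le (by exact_mod_cast le_top)).contDiffAt
  rw [hdiff]
  have h1 : ‖iteratedFDeriv ℝ N H (x, ζ) - iteratedFDeriv ℝ N H (x₀, ζ)‖
      ≤ (D / (1 + ‖ζ‖) ^ k) * ‖((x, ζ) : Rn n × Rn n) - (x₀, ζ)‖ := by
    have hconv : Convex ℝ (Metric.ball x₀ 1 ×ˢ ({ζ} : Set (Rn n))) :=
      (convex_ball x₀ 1).prod (convex_singleton ζ)
    refine hconv.norm_image_sub_le_of_norm_fderiv_le (𝕜 := ℝ) (f := iteratedFDeriv ℝ N H) ?_ ?_ ?_ ?_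
    · intro p _
      exact (hs.differentiable_iteratedFDeriv (by exact_mod_cast WithTop.coe_lt_top _)) p
    · rintro ⟨y, ζ'⟩ ⟨hy, hζ⟩
      obtain rfl : ζ' = ζ := hζ
      rw [norm_fderiv_iteratedFDeriv, le_div_iff₀ (by positivity), mul_comm]
      refine (h (y, ζ')).trans ?_
      have : ‖y‖ ≤ ‖x₀‖ + 1 := by
        have h2 : dist y x₀ < 1 := hy
        rw [dist_eq_norm] at h2
        have := norm_add_le x₀ (y - x₀)
        rw [add_sub_cancel] at this
        linarith
      rw [hD]
      have h3 : 1 + ‖y‖ ≤ 2 + ‖x₀‖ := by linarith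
      exact mul_le_mul_of_nonneg_left (pow_le_pow_left₀ (by positivity) h3 M) hC
    · exact ⟨Metric.mem_ball_self one_pos, rfl⟩
    · exact ⟨hx1, rfl⟩
  have h2 : ‖((x, ζ) : Rn n × Rn n) - (x₀, ζ)‖ = ‖x - x₀‖ := by simp [Prod.norm_def]
  rw [h2] at h1
  have h3 := ContinuousMultilinearMap.norm_compContinuousLinearMap_le
    (iteratedFDeriv ℝ N H (x, ζ) - iteratedFDeriv ℝ N H (x₀, ζ))
    (fun _ => ContinuousLinearMap.inr ℝ (Rn n) (Rn n))
  have h4 : ∏ _i : Fin N, ‖ContinuousLinearMap.inr ℝ (Rn n) (Rn n)‖ ≤ 1 :=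
    Finset.prod_le_one (fun _ _ => norm_nonneg _)
      (fun _ _ => ContinuousLinearMap.norm_inr_le_one ℝ (Rn n) (Rn n))
  have h5 := h3.trans (mul_le_of_le_one_right (norm_nonneg _) h4)
  have h6 : ‖ζ‖ ^ k ≤ (1 + ‖ζ‖) ^ k := by gcongr; simp
  calc _ ≤ (1 + ‖ζ‖) ^ k * ((D / (1 + ‖ζ‖) ^ k) * ‖x - x₀‖) :=
        mul_le_mul h6 (h5.trans h1) (norm_nonneg _) (by positivity)
    _ = D * ‖x - x₀‖ := by field_simp

/-- The function `(x, ζ) ↦ e^{2πi x·ζ} b(x, 2πζ)`. -/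
def phaseSymbol {n : ℕ} (b : Rn n → Rn n → ℂ) (p : Rn n × Rn n) : ℂ :=
  Complex.exp ((2 * Real.pi : ℝ) * Complex.I * (inner ℝ p.1 p.2 : ℝ)) *
    b p.1 ((2 * Real.pi) • p.2)

theorem hasTemperateGrowth_phase (n : ℕ) : Function.HasTemperateGrowth (fun p : Rn n × Rn n =>
    Complex.exp ((2 * Real.pi : ℝ) * Complex.I * (inner ℝ p.1 p.2 : ℝ))) := by
  have h1 : Function.HasTemperateGrowth (fun p : Rn n × Rn n => (inner ℝ p.1 p.2 : ℝ)) :=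
    (innerSL ℝ (E := Rn n)).bilinear_hasTemperateGrowth
      (ContinuousLinearMap.fst ℝ (Rn n) (Rn n)).hasTemperateGrowth
      (ContinuousLinearMap.snd ℝ (Rn n) (Rn n)).hasTemperateGrowth
  exact (hasTemperateGrowth_cexp (2 * Real.pi)).comp h1

theorem IsSmoothing.contDiff_phaseSymbol {n : ℕ} {b : Rn n → Rn n → ℂ} (hb : IsSmoothing b) :
    ContDiff ℝ ∞ (phaseSymbol b) := by
  refine (hasTemperateGrowth_phase n).1.mul ?_
  exact (hb 0).1.comp (contDiff_fst.prodMk (contDiff_snd.const_smul (2 * Real.pi)))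

theorem IsSmoothing.bound_phaseSymbol {n : ℕ} {b : Rn n → Rn n → ℂ} (hb : IsSmoothing b)
    (N K : ℕ) : ∃ (C : ℝ) (M : ℕ), ∀ p : Rn n × Rn n,
      (1 + ‖p.2‖) ^ K * ‖iteratedFDeriv ℝ N (phaseSymbol b) p‖ ≤ C * (1 + ‖p.1‖) ^ M := by
  obtain ⟨M, A, hA0, hA⟩ := (hasTemperateGrowth_phase n).norm_iteratedFDeriv_le_uniform N
  choose B hB0 hB using fun j => hb.bound j (K + M)
  set L : Rn n × Rn n →L[ℝ] Rn n × Rn n := (ContinuousLinearMap.fst ℝ (Rn n) (Rn n)).prod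
    ((2 * Real.pi) • ContinuousLinearMap.snd ℝ (Rn n) (Rn n)) with hL
  refine ⟨∑ i ∈ Finset.range (N + 1), (N.choose i : ℝ) * A * (B (N - i) * ‖L‖ ^ (N - i)), M,
    fun p => ?_⟩
  have hsm : ContDiff ℝ ∞ ((fun p : Rn n × Rn n => b p.1 p.2) ∘ L) := (hb 0).1.comp L.contDiff
  have hmul := norm_iteratedFDeriv_mul_le (hasTemperateGrowth_phase n).1 hsm p (n := N)
    (by exact_mod_cast le_top)
  have hbL : ∀ j, (1 + ‖p.2‖) ^ (K + M) *
      ‖iteratedFDeriv ℝ j ((fun p : Rn n × Rn n => b p.1 p.2) ∘ L) p‖ ≤ B j * ‖L‖ ^ j := by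
    intro j
    rw [L.iteratedFDeriv_comp_right (n := ∞) (hb 0).1 p (by exact_mod_cast le_top)]
    have h1 := ContinuousMultilinearMap.norm_compContinuousLinearMap_le
      (iteratedFDeriv ℝ j (fun p : Rn n × Rn n => b p.1 p.2) (L p)) (fun _ => L)
    rw [Finset.prod_const, Finset.card_univ, Fintype.card_fin] at h1
    have h2 : (1 + ‖p.2‖) ^ (K + M) ≤ (1 + ‖(L p).2‖) ^ (K + M) := by
      have : (L p).2 = (2 * Real.pi) • p.2 := rfl
      rw [this, norm_smul, Real.norm_of_nonneg (by positivity)]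
      gcongr
      have : (1 : ℝ) ≤ 2 * Real.pi := by linarith [Real.pi_gt_three]
      nlinarith [norm_nonneg p.2]
    calc _ ≤ (1 + ‖(L p).2‖) ^ (K + M) *
          (‖iteratedFDeriv ℝ j (fun p : Rn n × Rn n => b p.1 p.2) (L p)‖ * ‖L‖ ^ j) := by
          gcongr
      _ = ((1 + ‖(L p).2‖) ^ (K + M) *
          ‖iteratedFDeriv ℝ j (fun p : Rn n × Rn n => b p.1 p.2) (L p)‖) * ‖L‖ ^ j := by ring
      _ ≤ _ := by gcongr; exact hB j (L p)
  have hexp : ∀ i ≤ N, ‖iteratedFDeriv ℝ i (fun p : Rn n × Rn n =>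
      Complex.exp ((2 * Real.pi : ℝ) * Complex.I * (inner ℝ p.1 p.2 : ℝ))) p‖
      ≤ A * ((1 + ‖p.1‖) ^ M * (1 + ‖p.2‖) ^ M) := by
    intro i hi
    refine (hA i hi p).trans ?_
    rw [← mul_pow]
    gcongr
    rw [Prod.norm_def]
    rcases max_cases ‖p.1‖ ‖p.2‖ with h | h <;> rw [h.1] <;>
      nlinarith [norm_nonneg p.1, norm_nonneg p.2, mul_nonneg (norm_nonneg p.1) (norm_nonneg p.2)]
  calc (1 + ‖p.2‖) ^ K * ‖iteratedFDeriv ℝ N (phaseSymbol b) p‖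
      ≤ (1 + ‖p.2‖) ^ K * ∑ i ∈ Finset.range (N + 1), (N.choose i : ℝ) *
        ‖iteratedFDeriv ℝ i (fun p : Rn n × Rn n =>
          Complex.exp ((2 * Real.pi : ℝ) * Complex.I * (inner ℝ p.1 p.2 : ℝ))) p‖ *
        ‖iteratedFDeriv ℝ (N - i) ((fun p : Rn n × Rn n => b p.1 p.2) ∘ L) p‖ := by
        gcongr
        exact hmul
    _ ≤ _ := by
        rw [Finset.mul_sum, Finset.sum_mul]
        refine Finset.sum_le_sum fun i hi => ?_
        have hi' : i ≤ N := Nat.lt_succ_iff.1 (Finset.mem_range.1 hi)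
        have e1 := hexp i hi'
        have e2 := hbL (N - i)
        calc _ ≤ (1 + ‖p.2‖) ^ K * ((N.choose i : ℝ) *
              (A * ((1 + ‖p.1‖) ^ M * (1 + ‖p.2‖) ^ M)) *
              ‖iteratedFDeriv ℝ (N - i) ((fun p : Rn n × Rn n => b p.1 p.2) ∘ L) p‖) := by
              gcongr
          _ = (N.choose i : ℝ) * A * ((1 + ‖p.2‖) ^ (K + M) *
              ‖iteratedFDeriv ℝ (N - i) ((fun p : Rn n × Rn n => b p.1 p.2) ∘ L) p‖) *
              (1 + ‖p.1‖) ^ M := by rw [pow_add]; ring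
          _ ≤ _ := by gcongr

/-- For `b ∈ S^{-∞}` and `x ∈ ℝⁿ`, the Schwartz function `ζ ↦ e^{2πi x·ζ} b(x, 2πζ)`. -/
def phaseSchwartz {n : ℕ} {b : Rn n → Rn n → ℂ} (hb : IsSmoothing b) (x : Rn n) : 𝓢(Rn n, ℂ) :=
  slice (phaseSymbol b) hb.contDiff_phaseSymbol hb.bound_phaseSymbol x

/-- For `b ∈ S^{-∞}` and `u ∈ 𝓢'`, the function
`OP(b)u(x) = ⟨û, (2π)⁻ⁿ e^{ix·η} b(x, η)⟩`, where `û` is the Fourier transform with kernel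
`e^{-ix·η}`. In terms of the Fourier transform `𝓕` with kernel `e^{-2πi x·ζ}` (substitute
`η = 2πζ`) this is `⟨𝓕 u, e^{2πi x·ζ} b(x, 2πζ)⟩`. -/
def opFun {n : ℕ} {b : Rn n → Rn n → ℂ} (hb : IsSmoothing b) (u : 𝓢'(Rn n, ℂ)) (x : Rn n) : ℂ :=
  (𝓕 u) (phaseSchwartz hb x)

theorem continuous_opFun {n : ℕ} {b : Rn n → Rn n → ℂ} (hb : IsSmoothing b) (u : 𝓢'(Rn n, ℂ)) :
    Continuous (opFun hb u) :=
  (𝓕 u).continuous.comp (continuous_slice _ hb.contDiff_phaseSymbol hb.bound_phaseSymbol)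

/-- The distribution `φ ↦ ∫ f φ` given by a continuous (or just locally integrable) `f`. -/
def distOfFun {n : ℕ} (f : Rn n → ℂ) : Dist n :=
  TestFunction.integralAgainstBilinCLM
    (ContinuousLinearMap.lsmul ℝ ℝ : ℝ →L[ℝ] ℂ →L[ℝ] ℂ) volume f

theorem distOfFun_apply {n : ℕ} {f : Rn n → ℂ} (hf : Continuous f)
    (φ : 𝓓((⊤ : TopologicalSpace.Opens (Rn n)), ℝ)) : distOfFun f φ = ∫ x, φ x • f x :=
  TestFunction.integralAgainstBilinCLM_eq_integral (hf.locallyIntegrable.locallyIntegrableOn _)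

/-- The linear operator `OP(b) : 𝓢' → 𝓓'` for `b ∈ S^{-∞}`. -/
def OP {n : ℕ} {b : Rn n → Rn n → ℂ} (hb : IsSmoothing b) : 𝓢'(Rn n, ℂ) →ₗ[ℂ] Dist n where
  toFun u := distOfFun (opFun hb u)
  map_add' u v := by
    ext φ
    have hi : ∀ w : 𝓢'(Rn n, ℂ), Integrable (fun x => φ x • opFun hb w x) := fun w =>
      TestFunction.integrable_bilin (ContinuousLinearMap.lsmul ℝ ℝ : ℝ →L[ℝ] ℂ →L[ℝ] ℂ)
        ((continuous_opFun hb w).locallyIntegrable.locallyIntegrableOn _) φ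
    change distOfFun (opFun hb (u + v)) φ =
      distOfFun (opFun hb u) φ + distOfFun (opFun hb v) φ
    simp only [distOfFun_apply (continuous_opFun hb _)]
    rw [← integral_add (hi u) (hi v)]
    congr 1
    ext1 x
    have : opFun hb (u + v) x = opFun hb u x + opFun hb v x := rfl
    rw [this, smul_add]
  map_smul' c u := by
    ext φ
    change distOfFun (opFun hb (c • u)) φ = c • distOfFun (opFun hb u) φ
    simp only [distOfFun_apply (continuous_opFun hb _)]
    rw [← integral_smul]
    congr 1
    ext1 x
    have : opFun hb (c • u) x = c • opFun hb u x := rfl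
    rw [this, smul_comm]

/-! ### Frequency modulation -/

/-- A modulation function: `ψ ∈ C₀^∞(ℝⁿ)` with `ψ = 1` in a neighbourhood of the origin. -/
structure Modulation (n : ℕ) where
  toFun : Rn n → ℂ
  contDiff : ContDiff ℝ ∞ toFun
  hasCompactSupport : HasCompactSupport toFun
  eventually_eq_one : ∀ᶠ ξ in 𝓝 (0 : Rn n), toFun ξ = 1

/-- The dilated function `ξ ↦ ψ(2^{-m} ξ)`. -/
def Modulation.dilate {n : ℕ} (ψ : Modulation n) (m : ℕ) (ξ : Rn n) : ℂ :=
  ψ.toFun (((2 : ℝ) ^ m)⁻¹ • ξ)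

/-- The Fourier multiplier `g(D)f = F⁻¹[g · f̂] = (F⁻¹g) * f` for `g ∈ C₀^∞(ℝⁿ)` and bounded
smooth `f`, where `F⁻¹g(y) = (2π)⁻ⁿ ∫ e^{iy·ξ} g(ξ) dξ = ∫ e^{2πi y·ζ} g(2πζ) dζ`. -/
def multiplier {n : ℕ} (g f : Rn n → ℂ) (x : Rn n) : ℂ :=
  ∫ y, 𝓕⁻ (fun ζ : Rn n => g ((2 * Real.pi) • ζ)) y * f (x - y)

/-- The symbol `ψ(2^{-m}D_x) a(x, η) ψ(2^{-m}η)`. -/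
def modulate {n : ℕ} (ψ : Modulation n) (m : ℕ) (a : Rn n → Rn n → ℂ) (x η : Rn n) : ℂ :=
  multiplier (ψ.dilate m) (fun x' => a x' η) x * ψ.dilate m η

/-- Smooth functions on `ℝⁿ × ℝⁿ`, all of whose derivatives grow polynomially in `η`, are preserved
by convolution in `x` with an integrable function. -/
theorem conv_aux {n : ℕ} {k : Rn n → ℝ} (hk : Integrable k) (N : ℕ) :
    ∀ {W : Type} [NormedAddCommGroup W] [NormedSpace ℝ W]
      (F : Rn n × Rn n → W) (_ : ContDiff ℝ ∞ F)
      (_ : ∀ j : ℕ, ∃ (C : ℝ) (M : ℕ), ∀ p : Rn n × Rn n,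
        ‖iteratedFDeriv ℝ j F p‖ ≤ C * (1 + ‖p.2‖) ^ M),
      ContDiff ℝ N (fun p : Rn n × Rn n => ∫ y, k y • F (p.1 - y, p.2)) ∧
      ∃ (C : ℝ) (M : ℕ), ∀ p : Rn n × Rn n,
        ‖iteratedFDeriv ℝ N (fun p : Rn n × Rn n => ∫ y, k y • F (p.1 - y, p.2)) p‖
          ≤ C * (1 + ‖p.2‖) ^ M := by
  have hmeas : ∀ {W : Type} [NormedAddCommGroup W] [NormedSpace ℝ W]
      (F : Rn n × Rn n → W) (_ : Continuous F) (p : Rn n × Rn n),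
      AEStronglyMeasurable (fun y => k y • F (p.1 - y, p.2)) volume := by
    intro W _ _ F hF p
    refine hk.1.smul (Continuous.aestronglyMeasurable ?_)
    fun_prop
  have hint : ∀ {W : Type} [NormedAddCommGroup W] [NormedSpace ℝ W]
      (F : Rn n × Rn n → W) (_ : Continuous F) (C : ℝ) (M : ℕ)
      (_ : ∀ p : Rn n × Rn n, ‖F p‖ ≤ C * (1 + ‖p.2‖) ^ M) (p : Rn n × Rn n),
      Integrable (fun y => k y • F (p.1 - y, p.2)) := by
    intro W _ _ F hF C M hC p
    refine (hk.norm.mul_const (C * (1 + ‖p.2‖) ^ M)).mono' (hmeas F hF p) ?_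
    refine Eventually.of_forall fun y => ?_
    rw [norm_smul]
    gcongr
    exact hC (p.1 - y, p.2)
  induction N with
  | zero =>
    intro W _ _ F hF hb
    obtain ⟨C, M, hC⟩ := hb 0
    simp only [norm_iteratedFDeriv_zero] at hC
    have hC0 : 0 ≤ C := by simpa using le_trans (norm_nonneg _) (hC 0)
    constructor
    · simp only [Nat.cast_zero]
      rw [contDiff_zero, continuous_iff_continuousAt]
      intro p₀
      refine continuousAt_of_dominated (bound := fun y => ‖k y‖ * (C * (2 + ‖p₀.2‖) ^ M))
        (Eventually.of_forall fun p => hmeas F hF.continuous p) ?_ (hk.norm.mul_const _) ?_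
      · filter_upwards [Metric.ball_mem_nhds p₀ one_pos] with p hp
        refine Eventually.of_forall fun y => ?_
        rw [norm_smul]
        gcongr
        refine (hC _).trans ?_
        have h1 : ‖p.2 - p₀.2‖ < 1 := by
          rw [Metric.mem_ball, dist_eq_norm] at hp
          exact (norm_snd_le (p - p₀)).trans_lt hp
        have h2 : ‖p.2‖ ≤ ‖p₀.2‖ + ‖p.2 - p₀.2‖ := by
          simpa using norm_add_le p₀.2 (p.2 - p₀.2)
        have h3 : 1 + ‖p.2‖ ≤ 2 + ‖p₀.2‖ := by linarith
        exact mul_le_mul_of_nonneg_left (pow_le_pow_left₀ (by positivity) h3 _) (by assumption)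
      · refine Eventually.of_forall fun y => ?_
        have := hF.continuous
        exact Continuous.continuousAt (by fun_prop)
    · refine ⟨(∫ y, ‖k y‖) * C, M, fun p => ?_⟩
      rw [norm_iteratedFDeriv_zero]
      refine (norm_integral_le_integral_norm _).trans ?_
      rw [mul_assoc, ← integral_mul_const]
      refine integral_mono (hint F hF.continuous C M hC p).norm (hk.norm.mul_const _) fun y => ?_
      simp only [norm_smul]
      gcongr
      exact hC (p.1 - y, p.2)
  | succ N ih =>
    intro W _ _ F hF hb
    obtain ⟨C, M, hC⟩ := hb 0
    obtain ⟨C', M', hC'⟩ := hb 1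
    simp only [norm_iteratedFDeriv_zero] at hC
    have hC'' : ∀ p, ‖fderiv ℝ F p‖ ≤ C' * (1 + ‖p.2‖) ^ M' := fun p => by
      rw [← norm_iteratedFDeriv_zero (𝕜 := ℝ), norm_iteratedFDeriv_fderiv]; exact hC' p
    have hC'0 : 0 ≤ C' := by simpa using le_trans (norm_nonneg _) (hC'' 0)
    have hF' : ContDiff ℝ ∞ (fderiv ℝ F) := (contDiff_infty_iff_fderiv.1 hF).2
    have hder : ∀ p, HasFDerivAt (fun p : Rn n × Rn n => ∫ y, k y • F (p.1 - y, p.2))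
        (∫ y, k y • fderiv ℝ F (p.1 - y, p.2)) p := by
      intro p₀
      have h1 : ∀ y, ∀ p ∈ Metric.ball p₀ 1, ‖k y • fderiv ℝ F (p.1 - y, p.2)‖
          ≤ ‖k y‖ * (C' * (2 + ‖p₀.2‖) ^ M') := by
        intro y p hp
        rw [norm_smul]
        gcongr
        refine (hC'' _).trans ?_
        have h1 : ‖p.2 - p₀.2‖ < 1 := by
          rw [Metric.mem_ball, dist_eq_norm] at hp
          exact (norm_snd_le (p - p₀)).trans_lt hp
        have h2 : ‖p.2‖ ≤ ‖p₀.2‖ + ‖p.2 - p₀.2‖ := by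
          simpa using norm_add_le p₀.2 (p.2 - p₀.2)
        have h3 : 1 + ‖p.2‖ ≤ 2 + ‖p₀.2‖ := by linarith
        exact mul_le_mul_of_nonneg_left (pow_le_pow_left₀ (by positivity) h3 _) hC'0
      have h2 : ∀ y, ∀ p : Rn n × Rn n, HasFDerivAt (fun p : Rn n × Rn n => k y • F (p.1 - y, p.2))
          (k y • fderiv ℝ F (p.1 - y, p.2)) p := by
        intro y p
        have h2 : HasFDerivAt (fun p : Rn n × Rn n => F (p - (y, 0)))
            (fderiv ℝ F (p - (y, 0))) p := by
          rw [hasFDerivAt_comp_sub]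
          exact ((contDiff_infty_iff_fderiv.1 hF).1 (p - (y, 0))).hasFDerivAt
        have h3 : ∀ p : Rn n × Rn n, p - (y, 0) = (p.1 - y, p.2) := fun p => by
          ext1 <;> simp
        simp only [h3] at h2
        exact h2.const_smul (k y)
      have h3 : Integrable (fun y => ‖k y‖ * (C' * (2 + ‖p₀.2‖) ^ M')) := hk.norm.mul_const _
      have h4 := hasFDerivAt_integral_of_dominated_of_fderiv_le (𝕜 := ℝ)
        (μ := (volume : Measure (Rn n)))
        (F := fun (p : Rn n × Rn n) (y : Rn n) => k y • F (p.1 - y, p.2))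
        (F' := fun (p : Rn n × Rn n) (y : Rn n) => k y • fderiv ℝ F (p.1 - y, p.2))
        (bound := fun y => ‖k y‖ * (C' * (2 + ‖p₀.2‖) ^ M')) (Metric.ball_mem_nhds p₀ one_pos)
        (Eventually.of_forall fun p => hmeas F hF.continuous p)
        (hint F hF.continuous C M hC p₀)
      exact h4 (hmeas _ hF'.continuous p₀) (Eventually.of_forall h1) h3
        (Eventually.of_forall fun y p _ => h2 y p)
    have hfd : fderiv ℝ (fun p : Rn n × Rn n => ∫ y, k y • F (p.1 - y, p.2)) =
        fun p => ∫ y, k y • fderiv ℝ F (p.1 - y, p.2) := funext fun p => (hder p).fderiv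
    obtain ⟨ih1, C₁, M₁, ih2⟩ := ih (fderiv ℝ F) hF' fun j => by
      obtain ⟨C, M, h⟩ := hb (j + 1)
      exact ⟨C, M, fun p => by rw [norm_iteratedFDeriv_fderiv]; exact h p⟩
    constructor
    · push_cast
      rw [contDiff_succ_iff_fderiv]
      refine ⟨fun p => (hder p).differentiableAt, by simp, ?_⟩
      rw [hfd]
      exact ih1
    · refine ⟨C₁, M₁, fun p => ?_⟩
      rw [← norm_iteratedFDeriv_fderiv, hfd]
      exact ih2 p

theorem Modulation.contDiff_dilate {n : ℕ} (ψ : Modulation n) (m : ℕ) :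
    ContDiff ℝ ∞ (ψ.dilate m) :=
  ψ.contDiff.comp (contDiff_id.const_smul _)

theorem Modulation.hasCompactSupport_dilate {n : ℕ} (ψ : Modulation n) (m : ℕ) :
    HasCompactSupport (ψ.dilate m) :=
  ψ.hasCompactSupport.comp_smul (inv_ne_zero (by positivity))

theorem integrable_multiplier_kernel {n : ℕ} {g : Rn n → ℂ} (hg : ContDiff ℝ ∞ g)
    (hc : HasCompactSupport g) :
    Integrable (𝓕⁻ (fun ζ : Rn n => g ((2 * Real.pi) • ζ))) := by
  have h1 : ContDiff ℝ ∞ (fun ζ : Rn n => g ((2 * Real.pi) • ζ)) :=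
    hg.comp (contDiff_id.const_smul _)
  have h2 : HasCompactSupport (fun ζ : Rn n => g ((2 * Real.pi) • ζ)) :=
    hc.comp_smul (by positivity)
  have h3 := (𝓕⁻ (h2.toSchwartzMap h1)).integrable (μ := volume)
  rwa [SchwartzMap.fourierInv_coe] at h3

theorem conv_symbol {n : ℕ} {κ : Rn n → ℂ} (hκ : Integrable κ) {a : Rn n → Rn n → ℂ}
    (ha : ∃ d : ℝ, IsSymbol d 1 1 a) :
    ContDiff ℝ ∞ (fun p : Rn n × Rn n => ∫ y, κ y * a (p.1 - y) p.2) ∧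
    ∀ N : ℕ, ∃ (C : ℝ) (M : ℕ), ∀ p : Rn n × Rn n,
      ‖iteratedFDeriv ℝ N (fun p : Rn n × Rn n => ∫ y, κ y * a (p.1 - y) p.2) p‖
        ≤ C * (1 + ‖p.2‖) ^ M := by
  obtain ⟨d, hd⟩ := ha
  set F : Rn n × Rn n → ℂ := fun p => a p.1 p.2 with hF
  have hb : ∀ j : ℕ, ∃ (C : ℝ) (M : ℕ), ∀ p : Rn n × Rn n,
      ‖iteratedFDeriv ℝ j F p‖ ≤ C * (1 + ‖p.2‖) ^ M := by
    intro j
    obtain ⟨C, hC0, hC⟩ := hd.bound j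
    obtain ⟨M, hM⟩ := exists_nat_ge (d + (|(1 : ℝ)| + |(1 : ℝ)|) * j)
    refine ⟨C, M, fun p => (hC p).trans ?_⟩
    rw [← Real.rpow_natCast]
    have : (1 : ℝ) ≤ 1 + ‖p.2‖ := by linarith [norm_nonneg p.2]
    gcongr
  have hsplit : (fun p : Rn n × Rn n => ∫ y, κ y * a (p.1 - y) p.2) =
      (fun p => ∫ y, (κ y).re • F (p.1 - y, p.2)) +
      Complex.I • (fun p => ∫ y, (κ y).im • F (p.1 - y, p.2)) := by
    obtain ⟨C, M, hC⟩ := hb 0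
    simp only [norm_iteratedFDeriv_zero] at hC
    have hi : ∀ (k : Rn n → ℝ) (_ : Integrable k) (p : Rn n × Rn n),
        Integrable (fun y => k y • F (p.1 - y, p.2)) := by
      intro k hk p
      have hc := hd.1.continuous
      refine (hk.norm.mul_const (C * (1 + ‖p.2‖) ^ M)).mono'
        (hk.1.smul (Continuous.aestronglyMeasurable (by fun_prop))) ?_
      refine Eventually.of_forall fun y => ?_
      rw [norm_smul]
      gcongr
      exact hC (p.1 - y, p.2)
    ext1 p
    simp only [Pi.add_apply, Pi.smul_apply]
    have hi1 : Integrable (fun y => (κ y).re • F (p.1 - y, p.2)) := hi _ hκ.re p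
    have hi2 : Integrable (fun y => Complex.I • (κ y).im • F (p.1 - y, p.2)) :=
      (hi _ hκ.im p).smul Complex.I
    rw [← integral_smul, ← integral_add hi1 hi2]
    congr 1
    ext1 y
    simp only [hF, Complex.real_smul, smul_eq_mul]
    conv_lhs => rw [← Complex.re_add_im (κ y)]
    ring
  have hre : Integrable (fun y => (κ y).re) := hκ.re
  have him : Integrable (fun y => (κ y).im) := hκ.im
  have h1 := fun N => conv_aux hre N F hd.1 hb
  have h2 := fun N => conv_aux him N F hd.1 hb
  have s1 := contDiff_infty.2 fun N => (h1 N).1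
  have s2 := contDiff_infty.2 fun N => (h2 N).1
  rw [hsplit]
  refine ⟨s1.add (s2.const_smul Complex.I), fun N => ?_⟩
  obtain ⟨C₁, M₁, hC₁⟩ := (h1 N).2
  obtain ⟨C₂, M₂, hC₂⟩ := (h2 N).2
  refine ⟨|C₁| + |C₂|, M₁ + M₂, fun p => ?_⟩
  have hIQ : ContDiffAt ℝ N (Complex.I • fun p : Rn n × Rn n =>
      ∫ y, (κ y).im • F (p.1 - y, p.2)) p := (h2 N).1.contDiffAt.const_smul Complex.I
  rw [iteratedFDeriv_add_apply (h1 N).1.contDiffAt hIQ,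
    iteratedFDeriv_const_smul_apply (h2 N).1.contDiffAt]
  have hp : (1 : ℝ) ≤ 1 + ‖p.2‖ := by linarith [norm_nonneg p.2]
  refine (norm_add_le _ _).trans ?_
  rw [norm_smul, Complex.norm_I, one_mul, add_mul]
  refine add_le_add ((hC₁ p).trans ?_) ((hC₂ p).trans ?_)
  · gcongr
    · exact le_abs_self _
    · omega
  · gcongr
    · exact le_abs_self _
    · omega

/-- The modulated symbol `ψ(2^{-m}D_x) a(x, η) ψ(2^{-m}η)` is in `S^{-∞}`. -/
theorem isSmoothing_modulate {n : ℕ} (ψ : Modulation n) (m : ℕ) {a : Rn n → Rn n → ℂ}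
    (ha : ∃ d : ℝ, IsSymbol d 1 1 a) : IsSmoothing (modulate ψ m a) := by
  obtain ⟨hG, hGb⟩ := conv_symbol (integrable_multiplier_kernel (ψ.contDiff_dilate m)
    (ψ.hasCompactSupport_dilate m)) ha
  set G : Rn n × Rn n → ℂ := fun p => ∫ y,
    𝓕⁻ (fun ζ : Rn n => ψ.dilate m ((2 * Real.pi) • ζ)) y * a (p.1 - y) p.2 with hGdef
  set snd := ContinuousLinearMap.snd ℝ (Rn n) (Rn n) with hsnd
  have hψ : ContDiff ℝ ∞ (ψ.dilate m ∘ snd) := (ψ.contDiff_dilate m).comp snd.contDiff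
  have heq : (fun p : Rn n × Rn n => modulate ψ m a p.1 p.2) =
      fun p => G p * (ψ.dilate m ∘ snd) p := rfl
  have hψb : ∀ j K : ℕ, ∃ C : ℝ, 0 ≤ C ∧ ∀ p : Rn n × Rn n,
      (1 + ‖p.2‖) ^ K * ‖iteratedFDeriv ℝ j (ψ.dilate m ∘ snd) p‖ ≤ C := by
    intro j K
    set h : Rn n → ℝ := fun η => (1 + ‖η‖) ^ K * ‖iteratedFDeriv ℝ j (ψ.dilate m) η‖ with hh
    have hc : Continuous h := by
      have := (ψ.contDiff_dilate m).continuous_iteratedFDeriv (m := j) (by exact_mod_cast le_top)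
      fun_prop
    have hs : HasCompactSupport h :=
      ((ψ.hasCompactSupport_dilate m).iteratedFDeriv j).norm.mul_left
    obtain ⟨η₀, hη₀⟩ := hc.exists_forall_ge_of_hasCompactSupport hs
    have hn : ‖snd‖ ≤ 1 := ContinuousLinearMap.norm_snd_le ℝ (Rn n) (Rn n)
    refine ⟨h η₀, by positivity, fun p => ?_⟩
    rw [snd.iteratedFDeriv_comp_right (ψ.contDiff_dilate m) p (by exact_mod_cast le_top)]
    have h1 := ContinuousMultilinearMap.norm_compContinuousLinearMap_le
      (iteratedFDeriv ℝ j (ψ.dilate m) (snd p)) (fun _ => snd)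
    have h2 := h1.trans (mul_le_of_le_one_right (norm_nonneg _)
      (Finset.prod_le_one (fun _ _ => norm_nonneg _) (fun _ _ => hn)))
    refine le_trans ?_ (hη₀ p.2)
    simp only [hh]
    gcongr
    exact h2
  refine IsSmoothing.of_bound ?_ fun N K => ?_
  · rw [heq]; exact hG.mul hψ
  choose A M hA using hGb
  choose B hB0 hB using hψb
  have hA0 : ∀ j, 0 ≤ A j := fun j => by simpa using le_trans (norm_nonneg _) (hA j 0)
  refine ⟨∑ i ∈ Finset.range (N + 1), (N.choose i : ℝ) * A i * B (N - i) (M i + K), fun p => ?_⟩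
  rw [heq]
  calc _ ≤ (1 + ‖p.2‖) ^ K * ∑ i ∈ Finset.range (N + 1), (N.choose i : ℝ) *
        ‖iteratedFDeriv ℝ i G p‖ * ‖iteratedFDeriv ℝ (N - i) (ψ.dilate m ∘ snd) p‖ := by
        gcongr
        exact norm_iteratedFDeriv_mul_le hG hψ p (by exact_mod_cast le_top)
    _ ≤ _ := by
        rw [Finset.mul_sum]
        refine Finset.sum_le_sum fun i _ => ?_
        have e1 := hA i p
        have e2 := hB (N - i) (M i + K) p
        calc _ ≤ (1 + ‖p.2‖) ^ K * ((N.choose i : ℝ) * (A i * (1 + ‖p.2‖) ^ M i) *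
              ‖iteratedFDeriv ℝ (N - i) (ψ.dilate m ∘ snd) p‖) := by gcongr
          _ = (N.choose i : ℝ) * A i * ((1 + ‖p.2‖) ^ (M i + K) *
              ‖iteratedFDeriv ℝ (N - i) (ψ.dilate m ∘ snd) p‖) := by rw [pow_add]; ring
          _ ≤ _ := by
              have := hA0 i
              gcongr

/-- The element `ψ(2^{-m}D_x) a(x, η) ψ(2^{-m}η)` of `S^∞_{1,1}`, for `a ∈ S^∞_{1,1}`. -/
def SymbolOneOne.modulate {n : ℕ} (a : SymbolOneOne n) (ψ : Modulation n) (m : ℕ) : SymbolOneOne n :=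
  ⟨TypeOneOne.modulate ψ m a.1, (isSmoothing_modulate ψ m a.2).exists_isSymbol⟩

/-! ### Type `1,1`-operators and operator assignments -/

/-- Convergence of a sequence in `𝓓'(ℝⁿ)`, that is, convergence on every test function. -/
def TendstoDist {n : ℕ} (T : ℕ → Dist n) (T₀ : Dist n) : Prop :=
  ∀ φ : 𝓓((⊤ : TopologicalSpace.Opens (Rn n)), ℝ), Tendsto (fun m => T m φ) atTop (𝓝 (T₀ φ))

theorem TendstoDist.unique {n : ℕ} {T : ℕ → Dist n} {S S' : Dist n} (h : TendstoDist T S)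
    (h' : TendstoDist T S') : S = S' := by
  ext φ
  exact tendsto_nhds_unique (h φ) (h' φ)

instance (n : ℕ) : Nonempty (Modulation n) := by
  let f : ContDiffBump (0 : Rn n) := ⟨1, 2, one_pos, one_lt_two⟩
  refine ⟨⟨fun ξ => (f ξ : ℂ), Complex.ofRealCLM.contDiff.comp f.contDiff,
    f.hasCompactSupport.comp_left (g := fun r : ℝ => (r : ℂ)) Complex.ofReal_zero, ?_⟩⟩
  filter_upwards [f.eventuallyEq_one] with ξ hξ
  simp [hξ]

/-- `T` is the limit in `𝓓'` of `OP(ψ(2^{-m}D_x) a(x, η) ψ(2^{-m}η)) u` as `m → ∞`, for every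
modulation function `ψ`. -/
def IsVFMLimit {n : ℕ} (a : SymbolOneOne n) (u : 𝓢'(Rn n, ℂ)) (T : Dist n) : Prop :=
  ∀ ψ : Modulation n, TendstoDist (fun m => OP (isSmoothing_modulate ψ m a.2) u) T

theorem IsVFMLimit.unique {n : ℕ} {a : SymbolOneOne n} {u : 𝓢'(Rn n, ℂ)} {S T : Dist n}
    (hS : IsVFMLimit a u S) (hT : IsVFMLimit a u T) : S = T :=
  (hS (Classical.arbitrary _)).unique (hT _)

theorem IsVFMLimit.add {n : ℕ} {a : SymbolOneOne n} {u v : 𝓢'(Rn n, ℂ)} {S T : Dist n}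
    (hS : IsVFMLimit a u S) (hT : IsVFMLimit a v T) : IsVFMLimit a (u + v) (S + T) := by
  intro ψ φ
  simp only [map_add]
  exact (hS ψ φ).add (hT ψ φ)

theorem IsVFMLimit.smul {n : ℕ} {a : SymbolOneOne n} {u : 𝓢'(Rn n, ℂ)} {S : Dist n}
    (c : ℂ) (hS : IsVFMLimit a u S) : IsVFMLimit a (c • u) (c • S) := by
  intro ψ φ
  simp only [map_smul]
  exact (hS ψ φ).const_smul c

theorem IsVFMLimit.zero {n : ℕ} (a : SymbolOneOne n) : IsVFMLimit a 0 0 := by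
  intro ψ φ
  simp only [map_zero]
  exact tendsto_const_nhds

/-- The operator `a(x, D)` defined by vanishing frequency modulation: `u ∈ 𝓢'` is in its domain
when `lim OP(ψ(2^{-m}D_x) a(x, η) ψ(2^{-m}η)) u` exists in `𝓓'` for every modulation function `ψ`
and does not depend on `ψ`, and then `a(x, D)u` is this limit. -/
def vfmOp {n : ℕ} (a : SymbolOneOne n) : 𝓢'(Rn n, ℂ) →ₗ.[ℂ] Dist n where
  domain :=
    { carrier := {u | ∃ T, IsVFMLimit a u T}
      add_mem' := fun ⟨_, hS⟩ ⟨_, hT⟩ => ⟨_, hS.add hT⟩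
      zero_mem' := ⟨0, IsVFMLimit.zero a⟩
      smul_mem' := fun c _ ⟨_, hS⟩ => ⟨_, hS.smul c⟩ }
  toFun :=
    { toFun := fun u => u.2.choose
      map_add' := fun u v =>
        (u + v).2.choose_spec.unique (u.2.choose_spec.add v.2.choose_spec)
      map_smul' := fun c u => (c • u).2.choose_spec.unique (u.2.choose_spec.smul c) }

/-- An operator assignment is compatible with `OP` on `S^{-∞}`: for every `b ∈ S^{-∞}` the operator
is defined on all of `𝓢'` and equals `OP(b)` there. -/
def IsCompatible {n : ℕ} (A : SymbolOneOne n → (𝓢'(Rn n, ℂ) →ₗ.[ℂ] Dist n)) : Prop :=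
  ∀ (b : SymbolOneOne n) (hb : IsSmoothing b.1) (u : 𝓢'(Rn n, ℂ)),
    ∃ hu : u ∈ (A b).domain, A b ⟨u, hu⟩ = OP hb u

/-- Every operator of the assignment is stable under vanishing frequency modulation: for every
`u` in the domain of `A b` and every modulation function `ψ`, the values
`A(ψ(2^{-m}D_x) b(x, η) ψ(2^{-m}η)) u` are defined and converge to `A(b)u` in `𝓓'`. -/
def IsStable {n : ℕ} (A : SymbolOneOne n → (𝓢'(Rn n, ℂ) →ₗ.[ℂ] Dist n)) : Prop :=
  ∀ (b : SymbolOneOne n) (ψ : Modulation n) (u : (A b).domain),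
    ∃ hu : ∀ m, (u : 𝓢'(Rn n, ℂ)) ∈ (A (b.modulate ψ m)).domain,
      TendstoDist (fun m => A (b.modulate ψ m) ⟨u, hu m⟩) (A b u)

end

end TypeOneOne

namespace TypeOneOne

/-! ### Uniform bounds -/

/-! Once it is known that `OP(b_{ψ,m})u → OP(b)u` for every `b ∈ S^{-∞}`, every modulation function
`ψ` and every `u ∈ 𝓢'`, the theorem is formal. That convergence says that vanishing frequency
modulation reproduces `OP` on `S^{-∞}`. Since every modulated symbol lies in `S^{-∞}`, stability of
`a(x, D)` then becomes its own definition. For a competing assignment, the two axioms together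
express its value at `u` as `lim OP(a_{ψ,m})u` for each `ψ`, so `u` is in the domain of `a(x, D)`
and the values agree.

The analytic work is thus all on `S^{-∞}` (`IsSmoothing.tendstoDist_OP_modulate`), and it gives the
rate `2^{-m}`. Write `b_{ψ,m} - b = (ψ(2^{-m}D_x)b - b) ψ(2^{-m}η) + b (ψ(2^{-m}η) - 1)`. In the
first term `ψ(2^{-m}D_x)b` is an average of the translates of `b` by `2^{-m}y` against a Schwartz
kernel of integral `ψ(0) = 1`; the mean value inequality and the finite first moment of the kernel
give `O(2^{-m})` at the price of one more derivative of `b`. In the second term `|ψ(2^{-m}η) - 1| ≤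
C 2^{-m}(1 + |η|)`, at the price of one power of the decay of `b`. All derivatives are treated alike
(`IsSmoothing.exists_bound_modulate_sub`).

Multiplication by the phase costs only polynomial factors. The Schwartz functions paired with `û`
therefore differ by `O(2^{-m})` in each seminorm, with polynomial growth in `x`; continuity of `û`
transfers this to the functions `OP(b_{ψ,m})u(x)`, and a compactly supported test function absorbs
the growth. -/

theorem exists_bound_forall_le {ι : Type*} {f : ℕ → ι → ℝ} (h : ∀ j, ∃ C, ∀ i, f j i ≤ C) (N : ℕ) :
    ∃ C, 0 ≤ C ∧ ∀ j ≤ N, ∀ i, f j i ≤ C := by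
  choose C hC using h
  refine ⟨∑ j ∈ Finset.range (N + 1), |C j|, Finset.sum_nonneg fun _ _ => abs_nonneg _,
    fun j hj i => (hC j i).trans ((le_abs_self _).trans ?_)⟩
  exact Finset.single_le_sum (f := fun j => |C j|) (fun _ _ => abs_nonneg _)
    (Finset.mem_range.2 (Nat.lt_succ_of_le hj))

/-- Leibniz' rule with one common bound per factor; the binomial coefficients add up to `2 ^ N`. -/
theorem norm_iteratedFDeriv_mul_le_of_forall_le {E : Type*} [NormedAddCommGroup E]
    [NormedSpace ℝ E] {f g : E → ℂ} (hf : ContDiff ℝ ∞ f) (hg : ContDiff ℝ ∞ g) {N : ℕ} {p : E}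
    {A B : ℝ} (hA : ∀ j ≤ N, ‖iteratedFDeriv ℝ j f p‖ ≤ A)
    (hB : ∀ j ≤ N, ‖iteratedFDeriv ℝ j g p‖ ≤ B) :
    ‖iteratedFDeriv ℝ N (fun q => f q * g q) p‖ ≤ 2 ^ N * (A * B) := by
  have hA0 : 0 ≤ A := (norm_nonneg _).trans (hA 0 (Nat.zero_le _))
  refine (norm_iteratedFDeriv_mul_le hf hg p (by exact_mod_cast le_top)).trans ?_
  have h2 : (2 : ℝ) ^ N = ∑ i ∈ Finset.range (N + 1), (N.choose i : ℝ) := by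
    exact_mod_cast (Nat.sum_range_choose N).symm
  rw [h2, Finset.sum_mul]
  refine Finset.sum_le_sum fun i hi => ?_
  rw [mul_assoc]
  gcongr
  · exact hA i (Nat.lt_succ_iff.1 (Finset.mem_range.1 hi))
  · exact hB _ (Nat.sub_le _ _)

theorem contDiff_phaseSymbol_of_contDiff {n : ℕ} {c : Rn n → Rn n → ℂ}
    (hc : ContDiff ℝ ∞ (fun p : Rn n × Rn n => c p.1 p.2)) : ContDiff ℝ ∞ (phaseSymbol c) :=
  (hasTemperateGrowth_phase n).1.mul
    (hc.comp (contDiff_fst.prodMk (contDiff_snd.const_smul (2 * Real.pi))))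

/-- Multiplication by the phase is bounded on rapidly decreasing symbols, with constants that do
not depend on the symbol. -/
theorem exists_bound_phaseSymbol (n N K : ℕ) : ∃ (D : ℝ) (M : ℕ), 0 ≤ D ∧
    ∀ (c : Rn n → Rn n → ℂ) (B : ℝ), ContDiff ℝ ∞ (fun p : Rn n × Rn n => c p.1 p.2) →
      (∀ j ≤ N, ∀ p : Rn n × Rn n, (1 + ‖p.2‖) ^ (K + M) *
        ‖iteratedFDeriv ℝ j (fun p : Rn n × Rn n => c p.1 p.2) p‖ ≤ B) →
      ∀ p : Rn n × Rn n, (1 + ‖p.2‖) ^ K * ‖iteratedFDeriv ℝ N (phaseSymbol c) p‖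
        ≤ D * B * (1 + ‖p.1‖) ^ M := by
  -- One exponent `M` serves all derivatives of the phase up to order `N`. It depends on the phase
  -- alone, so the extra decay asked of `c` is the same for every `c`.
  obtain ⟨M, A, hA0, hA⟩ := (hasTemperateGrowth_phase n).norm_iteratedFDeriv_le_uniform N
  set L : Rn n × Rn n →L[ℝ] Rn n × Rn n := (ContinuousLinearMap.fst ℝ (Rn n) (Rn n)).prod
    ((2 * Real.pi) • ContinuousLinearMap.snd ℝ (Rn n) (Rn n)) with hL
  refine ⟨2 ^ N * (A * (1 + ‖L‖) ^ N), M, by positivity, fun c B hc hB p => ?_⟩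
  have hB0 : 0 ≤ B := le_trans (by positivity) (hB 0 (Nat.zero_le _) 0)
  have hcL : ∀ j ≤ N, ‖iteratedFDeriv ℝ j ((fun p : Rn n × Rn n => c p.1 p.2) ∘ L) p‖
      ≤ B / (1 + ‖p.2‖) ^ (K + M) * (1 + ‖L‖) ^ N := by
    intro j hj
    rw [L.iteratedFDeriv_comp_right (n := ∞) hc p (by exact_mod_cast le_top)]
    have h1 := ContinuousMultilinearMap.norm_compContinuousLinearMap_le
      (iteratedFDeriv ℝ j (fun p : Rn n × Rn n => c p.1 p.2) (L p)) (fun _ => L)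
    rw [Finset.prod_const, Finset.card_univ, Fintype.card_fin] at h1
    -- The substitution `η = 2πζ` only enlarges the weight, because `2π ≥ 1`.
    have h2 : (1 + ‖p.2‖) ^ (K + M) ≤ (1 + ‖(L p).2‖) ^ (K + M) := by
      have : (L p).2 = (2 * Real.pi) • p.2 := rfl
      rw [this, norm_smul, Real.norm_of_nonneg (by positivity)]
      gcongr
      have : (1 : ℝ) ≤ 2 * Real.pi := by linarith [Real.pi_gt_three]
      nlinarith [norm_nonneg p.2]
    refine h1.trans (mul_le_mul ?_ ?_ (by positivity) (by positivity))
    · rw [le_div_iff₀ (by positivity), mul_comm]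
      exact (mul_le_mul_of_nonneg_right h2 (norm_nonneg _)).trans (hB j hj (L p))
    · calc ‖L‖ ^ j ≤ (1 + ‖L‖) ^ j := by gcongr; linarith
        _ ≤ _ := pow_le_pow_right₀ (by linarith [norm_nonneg L]) hj
  -- The growth is split as `1 + max(|x|, |ζ|) ≤ (1 + |x|)(1 + |ζ|)`: the factor in `x` stays in the
  -- final bound, the factor in `ζ` cancels against the `M` spare powers of decay.
  have hexp : ∀ i ≤ N, ‖iteratedFDeriv ℝ i (fun p : Rn n × Rn n =>
      Complex.exp ((2 * Real.pi : ℝ) * Complex.I * (inner ℝ p.1 p.2 : ℝ))) p‖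
      ≤ A * ((1 + ‖p.1‖) ^ M * (1 + ‖p.2‖) ^ M) := by
    intro i hi
    refine (hA i hi p).trans ?_
    rw [← mul_pow]
    gcongr
    rw [Prod.norm_def]
    rcases max_cases ‖p.1‖ ‖p.2‖ with h | h <;> rw [h.1] <;>
      nlinarith [norm_nonneg p.1, norm_nonneg p.2, mul_nonneg (norm_nonneg p.1) (norm_nonneg p.2)]
  have hmul := norm_iteratedFDeriv_mul_le_of_forall_le (hasTemperateGrowth_phase n).1
    (hc.comp L.contDiff) hexp hcL
  calc _ ≤ (1 + ‖p.2‖) ^ K * (2 ^ N * (A * ((1 + ‖p.1‖) ^ M * (1 + ‖p.2‖) ^ M) *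
        (B / (1 + ‖p.2‖) ^ (K + M) * (1 + ‖L‖) ^ N))) :=
        mul_le_mul_of_nonneg_left hmul (by positivity)
    _ = _ := by rw [pow_add]; field_simp

/-! ### Averages of translates -/

/-- An average over translates by `t y` differs from the function itself by `O(|t|)`, together with
all derivatives. -/
theorem norm_iteratedFDeriv_integral_translate_sub_le {n : ℕ} {κ : Rn n → ℂ} (hκ : Integrable κ)
    (hκ' : Integrable (fun y => ‖y‖ * ‖κ y‖)) (t : ℝ) (N : ℕ) :
    ∀ {W : Type} [NormedAddCommGroup W] [NormedSpace ℝ W] [NormedSpace ℂ W] [SMulCommClass ℝ ℂ W]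
      (F : Rn n × Rn n → W) (_ : ContDiff ℝ ∞ F)
      (_ : ∀ j : ℕ, ∃ C : ℝ, ∀ p : Rn n × Rn n, ‖iteratedFDeriv ℝ j F p‖ ≤ C)
      (p : Rn n × Rn n) (C : ℝ) (_ : ∀ x, ‖iteratedFDeriv ℝ (N + 1) F (x, p.2)‖ ≤ C),
      ‖iteratedFDeriv ℝ N (fun p : Rn n × Rn n => ∫ y, κ y • (F (p.1 - t • y, p.2) - F p)) p‖
        ≤ |t| * C * ∫ y, ‖y‖ * ‖κ y‖ := by
  induction N with
  | zero =>
    intro W _ _ _ _ F hF _ p C hC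
    rw [norm_iteratedFDeriv_zero, ← integral_const_mul]
    refine norm_integral_le_of_norm_le (hκ'.const_mul _) (Eventually.of_forall fun y => ?_)
    -- The translation moves only `x`, so the mean value inequality can stay on the slice `η = p.2`,
    -- where `C` is a bound. This keeps the decay in `η` of the final estimate.
    have hconv : Convex ℝ ((Set.univ : Set (Rn n)) ×ˢ ({p.2} : Set (Rn n))) :=
      convex_univ.prod (convex_singleton p.2)
    have h := hconv.norm_image_sub_le_of_norm_fderiv_le (𝕜 := ℝ) (f := F) (C := C)
      (x := p) (y := (p.1 - t • y, p.2))
      (fun q _ => (contDiff_infty_iff_fderiv.1 hF).1 q) ?_ ⟨trivial, rfl⟩ ⟨trivial, rfl⟩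
    · have h2 : ‖((p.1 - t • y, p.2) : Rn n × Rn n) - p‖ = |t| * ‖y‖ := by
        simp only [Prod.norm_def, Prod.fst_sub, Prod.snd_sub, sub_sub_cancel_left, norm_neg,
          norm_smul, Real.norm_eq_abs, sub_self, norm_zero]
        exact max_eq_left (by positivity)
      rw [h2] at h
      rw [norm_smul]
      calc _ ≤ ‖κ y‖ * (C * (|t| * ‖y‖)) := mul_le_mul_of_nonneg_left h (norm_nonneg _)
        _ = _ := by ring
    · rintro ⟨x, η⟩ ⟨-, hη⟩
      obtain rfl : η = p.2 := hη
      rw [← norm_iteratedFDeriv_zero (𝕜 := ℝ), norm_iteratedFDeriv_fderiv]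
      exact hC x
  | succ N ih =>
    intro W _ _ _ _ F hF hb p C hC
    -- The induction replaces `F` by `fderiv ℝ F`, whose values lie in another space; hence the
    -- general `W`.
    have hF' : ContDiff ℝ ∞ (fderiv ℝ F) := (contDiff_infty_iff_fderiv.1 hF).2
    -- The global bounds `C₀` and `C₁` serve only to differentiate under the integral sign; they do
    -- not enter the final constant.
    obtain ⟨C₀, hC₀⟩ := hb 0
    obtain ⟨C₁, hC₁⟩ := hb 1
    simp only [norm_iteratedFDeriv_zero] at hC₀
    have hC₁' : ∀ p, ‖fderiv ℝ F p‖ ≤ C₁ := fun p => by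
      rw [← norm_iteratedFDeriv_zero (𝕜 := ℝ), norm_iteratedFDeriv_fderiv]; exact hC₁ p
    have hmeas : ∀ {V : Type} [NormedAddCommGroup V] [NormedSpace ℂ V]
        (G : Rn n × Rn n → V) (_ : Continuous G) (p : Rn n × Rn n),
        AEStronglyMeasurable (fun y => κ y • (G (p.1 - t • y, p.2) - G p)) volume := by
      intro V _ _ G hG p
      refine hκ.1.smul (Continuous.aestronglyMeasurable ?_)
      fun_prop
    have hder : ∀ p, HasFDerivAt
        (fun p : Rn n × Rn n => ∫ y, κ y • (F (p.1 - t • y, p.2) - F p))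
        (∫ y, κ y • (fderiv ℝ F (p.1 - t • y, p.2) - fderiv ℝ F p)) p := by
      intro p₀
      have h1 : ∀ y, ∀ p : Rn n × Rn n,
          HasFDerivAt (fun p : Rn n × Rn n => κ y • (F (p.1 - t • y, p.2) - F p))
          (κ y • (fderiv ℝ F (p.1 - t • y, p.2) - fderiv ℝ F p)) p := by
        intro y p
        have h2 : HasFDerivAt (fun p : Rn n × Rn n => F (p - (t • y, 0)))
            (fderiv ℝ F (p - (t • y, 0))) p := by
          rw [hasFDerivAt_comp_sub]
          exact ((contDiff_infty_iff_fderiv.1 hF).1 _).hasFDerivAt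
        have h3 : ∀ p : Rn n × Rn n, p - (t • y, 0) = (p.1 - t • y, p.2) := fun p => by
          ext1 <;> simp
        simp only [h3] at h2
        exact (h2.sub ((contDiff_infty_iff_fderiv.1 hF).1 p).hasFDerivAt).const_smul (κ y)
      have h2 : Integrable (fun y => κ y • (F (p₀.1 - t • y, p₀.2) - F p₀)) := by
        refine (hκ.norm.mul_const (C₀ + C₀)).mono' (hmeas F hF.continuous p₀)
          (Eventually.of_forall fun y => ?_)
        rw [norm_smul]
        gcongr
        exact (norm_sub_le _ _).trans (add_le_add (hC₀ _) (hC₀ _))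
      refine hasFDerivAt_integral_of_dominated_of_fderiv_le (𝕜 := ℝ)
        (bound := fun y => ‖κ y‖ * (C₁ + C₁)) univ_mem
        (Eventually.of_forall fun p => hmeas F hF.continuous p) h2
        (hmeas _ hF'.continuous p₀) (Eventually.of_forall fun y p _ => ?_) (hκ.norm.mul_const _)
        (Eventually.of_forall fun y p _ => h1 y p)
      rw [norm_smul]
      gcongr
      exact (norm_sub_le _ _).trans (add_le_add (hC₁' _) (hC₁' _))
    rw [← norm_iteratedFDeriv_fderiv, funext fun p => (hder p).fderiv]
    refine ih (fderiv ℝ F) hF' (fun j => ?_) p C fun x => ?_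
    · obtain ⟨C, h⟩ := hb (j + 1)
      exact ⟨C, fun p => by rw [norm_iteratedFDeriv_fderiv]; exact h p⟩
    · rw [norm_iteratedFDeriv_fderiv]; exact hC x

/-! ### Modulation functions and their kernels -/

noncomputable section

theorem Modulation.toFun_zero {n : ℕ} (ψ : Modulation n) : ψ.toFun 0 = 1 :=
  ψ.eventually_eq_one.self_of_nhds

/-- The convolution kernel of the Fourier multiplier `ψ(D)`, as a Schwartz function. -/
def Modulation.kernel {n : ℕ} (ψ : Modulation n) : 𝓢(Rn n, ℂ) :=
  𝓕⁻ ((ψ.hasCompactSupport.comp_smul (c := 2 * Real.pi) (by positivity)).toSchwartzMap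
    (ψ.contDiff.comp (contDiff_id.const_smul _)))

theorem Modulation.kernel_coe {n : ℕ} (ψ : Modulation n) :
    (ψ.kernel : Rn n → ℂ) = 𝓕⁻ (fun ζ : Rn n => ψ.toFun ((2 * Real.pi) • ζ)) := by
  rw [Modulation.kernel, SchwartzMap.fourierInv_coe]
  rfl

/-- The integral of the kernel is its Fourier transform at the origin, which is `ψ(0)`. -/
theorem Modulation.integral_kernel {n : ℕ} (ψ : Modulation n) : ∫ y, ψ.kernel y = 1 := by
  have h : 𝓕 ψ.kernel 0 = ψ.toFun ((2 * Real.pi) • 0) := by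
    rw [Modulation.kernel, FourierTransform.fourier_fourierInv_eq]
    rfl
  rw [smul_zero, ψ.toFun_zero, SchwartzMap.fourier_coe, Real.fourier_eq] at h
  simpa using h

/-- The kernel of `ψ(2^{-m}D)` is `2^{mn} k(2^m y)`, with `k` the kernel of `ψ(D)`. Rescaling the
convolution variable moves all dependence on `m` into the length of the translations. -/
theorem multiplier_dilate {n : ℕ} (ψ : Modulation n) (m : ℕ) (f : Rn n → ℂ) (x : Rn n) :
    multiplier (ψ.dilate m) f x = ∫ y, ψ.kernel y * f (x - ((2 : ℝ) ^ m)⁻¹ • y) := by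
  have hR : (0 : ℝ) < 2 ^ m := by positivity
  set R : ℝ := 2 ^ m
  -- This is the scaling law of the inverse Fourier transform, evaluated at the rescaled point. Its
  -- factor `R ^ n` cancels against the Jacobian of the convolution integral in `h2`.
  have h1 : ∀ y : Rn n, 𝓕⁻ (fun ζ : Rn n => ψ.dilate m ((2 * Real.pi) • ζ)) (R⁻¹ • y) =
      R ^ Module.finrank ℝ (Rn n) • ψ.kernel y := by
    intro y
    rw [ψ.kernel_coe, Real.fourierInv_eq, Real.fourierInv_eq,
      ← Measure.integral_comp_inv_smul_of_nonneg volume _ hR.le]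
    congr 1
    ext1 v
    rw [inner_smul_left, inner_smul_right, smul_comm]
    rfl
  have h2 := Measure.integral_comp_inv_smul_of_nonneg volume
    (fun y => 𝓕⁻ (fun ζ : Rn n => ψ.dilate m ((2 * Real.pi) • ζ)) y * f (x - y)) hR.le
  simp only [h1, smul_mul_assoc] at h2
  rw [integral_smul] at h2
  exact (smul_right_injective ℂ (pow_pos hR _).ne' h2).symm

/-- With `t = 2^{-m} ≤ 1`, a derivative of order `j` of `ψ(tη)` carries `t ^ j`. After subtracting
`1`, orders `j ≥ 1` therefore keep a factor `t`; order `0` gets `t|η|` from the mean value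
inequality between `0` and `tη`, as `ψ(0) = 1`. -/
theorem Modulation.exists_bound_dilate {n : ℕ} (ψ : Modulation n) (N : ℕ) : ∃ C : ℝ, 0 ≤ C ∧
    ∀ (m : ℕ), ∀ j ≤ N, ∀ p : Rn n × Rn n,
      ‖iteratedFDeriv ℝ j (fun p : Rn n × Rn n => ψ.dilate m p.2) p‖ ≤ C ∧
      ‖iteratedFDeriv ℝ j (fun p : Rn n × Rn n => ψ.dilate m p.2 - 1) p‖
        ≤ C * ((2 : ℝ) ^ m)⁻¹ * (1 + ‖p.2‖) := by
  have hb : ∀ j, ∃ C, ∀ η, ‖iteratedFDeriv ℝ j ψ.toFun η‖ ≤ C := fun j =>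
    (ψ.hasCompactSupport.iteratedFDeriv j).exists_bound_of_continuous
      (ψ.contDiff.continuous_iteratedFDeriv (by exact_mod_cast le_top))
  -- The estimate of order `0` uses the first derivative of `ψ`, so order `N + 1` is needed when `N
  -- = 0`.
  obtain ⟨C, hC0, hC⟩ := exists_bound_forall_le hb (N + 1)
  refine ⟨C, hC0, fun m => ?_⟩
  have ht0 : (0 : ℝ) < (2 ^ m)⁻¹ := by positivity
  have ht1 : ((2 : ℝ) ^ m)⁻¹ ≤ 1 := inv_le_one_of_one_le₀ (one_le_pow₀ one_le_two)
  unfold Modulation.dilate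
  set t : ℝ := (2 ^ m)⁻¹
  set L : Rn n × Rn n →L[ℝ] Rn n := t • ContinuousLinearMap.snd ℝ (Rn n) (Rn n)
  have hL : ‖L‖ ≤ t := by
    rw [norm_smul, Real.norm_of_nonneg ht0.le]
    exact mul_le_of_le_one_right ht0.le (ContinuousLinearMap.norm_snd_le ℝ _ _)
  have h : ∀ j ≤ N, ∀ p : Rn n × Rn n,
      ‖iteratedFDeriv ℝ j (fun p : Rn n × Rn n => ψ.toFun (t • p.2)) p‖ ≤ C * t ^ j := by
    intro j hj p
    change ‖iteratedFDeriv ℝ j (ψ.toFun ∘ L) p‖ ≤ _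
    rw [L.iteratedFDeriv_comp_right ψ.contDiff p (by exact_mod_cast le_top)]
    refine (ContinuousMultilinearMap.norm_compContinuousLinearMap_le _ _).trans ?_
    rw [Finset.prod_const, Finset.card_univ, Fintype.card_fin]
    gcongr
    exact hC j (by omega) _
  refine fun j hj p => ⟨(h j hj p).trans (mul_le_of_le_one_right hC0 (pow_le_one₀ ht0.le ht1)), ?_⟩
  have hp : (1 : ℝ) ≤ 1 + ‖p.2‖ := by linarith [norm_nonneg p.2]
  rcases j with _ | j
  · rw [norm_iteratedFDeriv_zero, ← ψ.toFun_zero]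
    have h2 := convex_univ.norm_image_sub_le_of_norm_fderiv_le (𝕜 := ℝ) (f := ψ.toFun) (C := C)
      (x := 0) (y := t • p.2) (fun q _ => (contDiff_infty_iff_fderiv.1 ψ.contDiff).1 q)
      (fun q _ => by
        rw [← norm_iteratedFDeriv_zero (𝕜 := ℝ), norm_iteratedFDeriv_fderiv]
        exact hC 1 (by omega) q) trivial trivial
    rw [sub_zero, norm_smul, Real.norm_of_nonneg ht0.le, ← mul_assoc] at h2
    refine h2.trans ?_
    gcongr
    linarith
  · have hs : ContDiff ℝ ∞ (fun p : Rn n × Rn n => ψ.toFun (t • p.2)) :=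
      ψ.contDiff.comp L.contDiff
    have e : (fun p : Rn n × Rn n => ψ.toFun (t • p.2) - 1) =
      (fun p : Rn n × Rn n => ψ.toFun (t • p.2)) - fun _ => 1 := rfl
    rw [e, iteratedFDeriv_sub_apply (hs.of_le (by exact_mod_cast le_top)).contDiffAt
      contDiffAt_const, iteratedFDeriv_succ_const, Pi.zero_apply, sub_zero]
    refine (h _ hj p).trans ?_
    rw [pow_succ, mul_comm (t ^ j), ← mul_assoc]
    exact (mul_le_of_le_one_right (by positivity) (pow_le_one₀ ht0.le ht1)).trans
      (le_mul_of_one_le_right (by positivity) hp)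

/-! ### Convergence of the modulated symbols -/

/-- For `b ∈ S^{-∞}` the symbols `ψ(2^{-m}D_x) b(x, η) ψ(2^{-m}η)` converge to `b` in `S^{-∞}`, at
the rate `2^{-m}`. -/
theorem IsSmoothing.exists_bound_modulate_sub {n : ℕ} {b : Rn n → Rn n → ℂ} (hb : IsSmoothing b)
    (ψ : Modulation n) (N K : ℕ) : ∃ C : ℝ, ∀ (i : ℕ × (Rn n × Rn n)),
      2 ^ i.1 * ((1 + ‖i.2.2‖) ^ K * ‖iteratedFDeriv ℝ N
        (fun p : Rn n × Rn n => modulate ψ i.1 b p.1 p.2 - b p.1 p.2) i.2‖) ≤ C := by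
  set F : Rn n × Rn n → ℂ := fun p => b p.1 p.2 with hF
  have hFs : ContDiff ℝ ∞ F := (hb 0).1
  have hκ : Integrable ψ.kernel := ψ.kernel.integrable
  have hκ' : Integrable (fun y => ‖y‖ * ‖ψ.kernel y‖) := by
    simpa using ψ.kernel.integrable_pow_mul volume 1
  -- The spare power in `K + 1` pays for the factor `1 + |η|` from `ψ(2^{-m}η) - 1`; the spare order
  -- in `N + 1` is the derivative lost in the averaging estimate.
  obtain ⟨B, hB0, hB⟩ := exists_bound_forall_le
    (f := fun j (p : Rn n × Rn n) => (1 + ‖p.2‖) ^ (K + 1) * ‖iteratedFDeriv ℝ j F p‖)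
    (fun j => (hb.bound j (K + 1)).imp fun _ h => h.2) (N + 1)
  obtain ⟨P, hP0, hP⟩ := ψ.exists_bound_dilate N
  set I : ℝ := ∫ y, ‖y‖ * ‖ψ.kernel y‖ with hI
  have hI0 : 0 ≤ I := integral_nonneg fun y => by positivity
  refine ⟨2 ^ N * (B * I * P) + 2 ^ N * (B * P), fun ⟨m, p⟩ => ?_⟩
  have ht0 : (0 : ℝ) < (2 ^ m)⁻¹ := by positivity
  have hp : (0 : ℝ) < 1 + ‖p.2‖ := by positivity
  set D : Rn n × Rn n → ℂ := fun p =>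
    ∫ y, ψ.kernel y • (F (p.1 - ((2 : ℝ) ^ m)⁻¹ • y, p.2) - F p) with hD
  -- Because the kernel has integral `1`, `F p` can be put under the integral sign.
  have hDeq : D = fun p => multiplier (ψ.dilate m) (fun x => b x p.2) p.1 - F p := by
    ext1 p
    obtain ⟨C, -, hC⟩ := hb.bound 0 0
    simp only [pow_zero, one_mul, norm_iteratedFDeriv_zero] at hC
    have hc := hFs.continuous
    have hi1 : Integrable (fun y => ψ.kernel y * F (p.1 - ((2 : ℝ) ^ m)⁻¹ • y, p.2)) :=
      hκ.mul_bdd (c := C) (Continuous.aestronglyMeasurable (by fun_prop))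
        (Eventually.of_forall fun y => hC _)
    simp only [hD, smul_eq_mul, mul_sub]
    rw [integral_sub hi1 (hκ.mul_const _), integral_mul_const, ψ.integral_kernel, one_mul,
      multiplier_dilate]
  have hDs : ContDiff ℝ ∞ D := by
    rw [hDeq]
    exact (conv_symbol (integrable_multiplier_kernel (ψ.contDiff_dilate m)
      (ψ.hasCompactSupport_dilate m)) hb.exists_isSymbol).1.sub hFs
  have hψs : ContDiff ℝ ∞ (fun p : Rn n × Rn n => ψ.dilate m p.2) :=
    (ψ.contDiff_dilate m).comp contDiff_snd
  have hψs' : ContDiff ℝ ∞ (fun p : Rn n × Rn n => ψ.dilate m p.2 - 1) := hψs.sub contDiff_const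
  have hsplit : (fun p : Rn n × Rn n => modulate ψ m b p.1 p.2 - b p.1 p.2) =
      (fun p => D p * ψ.dilate m p.2) + fun p => F p * (ψ.dilate m p.2 - 1) := by
    ext1 p
    simp only [Pi.add_apply, hDeq, modulate, hF]
    ring
  have hFb : ∀ j ≤ N + 1, ∀ q : Rn n × Rn n, q.2 = p.2 →
      ‖iteratedFDeriv ℝ j F q‖ ≤ B / (1 + ‖p.2‖) ^ (K + 1) := by
    intro j hj q hq
    rw [le_div_iff₀ (by positivity), mul_comm, ← hq]
    exact hB j hj q
  have h1 := norm_iteratedFDeriv_mul_le_of_forall_le hDs hψs (p := p) (N := N)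
    (A := (2 ^ m)⁻¹ * (B / (1 + ‖p.2‖) ^ (K + 1)) * I) (B := P)
    (fun j hj => by
      have := norm_iteratedFDeriv_integral_translate_sub_le hκ hκ' ((2 : ℝ) ^ m)⁻¹ j F hFs
        (fun j => (hb.bound j 0).imp fun _ h => by simpa using h.2) p _
        (fun x => hFb (j + 1) (by omega) (x, p.2) rfl)
      rwa [abs_of_pos ht0] at this)
    (fun j hj => (hP m j hj p).1)
  have h2 := norm_iteratedFDeriv_mul_le_of_forall_le hFs hψs' (p := p) (N := N)
    (A := B / (1 + ‖p.2‖) ^ (K + 1)) (B := P * ((2 : ℝ) ^ m)⁻¹ * (1 + ‖p.2‖))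
    (fun j hj => hFb j (by omega) p rfl) (fun j hj => (hP m j hj p).2)
  simp only
  rw [hsplit, iteratedFDeriv_add_apply
    ((hDs.mul hψs).of_le (by exact_mod_cast le_top)).contDiffAt
    ((hFs.mul hψs').of_le (by exact_mod_cast le_top)).contDiffAt]
  have h3 : (1 : ℝ) ≤ 1 + ‖p.2‖ := by linarith [norm_nonneg p.2]
  calc _ ≤ 2 ^ m * ((1 + ‖p.2‖) ^ K *
        (2 ^ N * ((2 ^ m)⁻¹ * (B / (1 + ‖p.2‖) ^ (K + 1)) * I * P) +
          2 ^ N * (B / (1 + ‖p.2‖) ^ (K + 1) * (P * ((2 : ℝ) ^ m)⁻¹ * (1 + ‖p.2‖))))) := by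
        gcongr
        exact (norm_add_le _ _).trans (add_le_add h1 h2)
    _ = 2 ^ N * (B * I * P) / (1 + ‖p.2‖) + 2 ^ N * (B * P) := by
        rw [pow_succ]; field_simp
    _ ≤ _ := by
        gcongr
        exact div_le_self (by positivity) h3

/-- The phase multiplication is linear in the symbol and its bound is linear in the bound `B` of the
symbol, so the rate `2^{-m}` passes to the Schwartz seminorms. -/
theorem IsSmoothing.exists_seminorm_phaseSchwartz_sub_le {n : ℕ} {b : Rn n → Rn n → ℂ}
    (hb : IsSmoothing b) (ψ : Modulation n) (k N : ℕ) : ∃ (C : ℝ) (M : ℕ), 0 ≤ C ∧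
      ∀ (m : ℕ) (x : Rn n), SchwartzMap.seminorm ℂ k N
        (phaseSchwartz (isSmoothing_modulate ψ m hb.exists_isSymbol) x - phaseSchwartz hb x)
        ≤ C * ((2 : ℝ) ^ m)⁻¹ * (1 + ‖x‖) ^ M := by
  obtain ⟨D, M, hD0, hD⟩ := exists_bound_phaseSymbol n N k
  -- The index is the pair `(m, p)`, so that `C` is independent of `m` as well. The weight `k + M`
  -- includes the powers that the phase will consume.
  obtain ⟨C, hC0, hC⟩ := exists_bound_forall_le
    (fun j => hb.exists_bound_modulate_sub ψ j (k + M)) N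
  refine ⟨D * C, M, by positivity, fun m x => ?_⟩
  have hm := isSmoothing_modulate ψ m hb.exists_isSymbol
  refine SchwartzMap.seminorm_le_bound ℂ k N _ (by positivity) fun ζ => ?_
  set c : Rn n → Rn n → ℂ := fun x η => modulate ψ m b x η - b x η with hc
  have hcs : ContDiff ℝ ∞ (fun p : Rn n × Rn n => c p.1 p.2) := (hm 0).1.sub (hb 0).1
  have e : ((phaseSchwartz hm x - phaseSchwartz hb x : 𝓢(Rn n, ℂ)) : Rn n → ℂ) =
      fun ζ => phaseSymbol c (x, ζ) := by
    ext1 ζ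
    exact (mul_sub _ _ _).symm
  rw [e, iteratedFDeriv_slice (contDiff_phaseSymbol_of_contDiff hcs)]
  have h1 := (ContinuousMultilinearMap.norm_compContinuousLinearMap_le
    (iteratedFDeriv ℝ N (phaseSymbol c) (x, ζ))
    (fun _ => ContinuousLinearMap.inr ℝ (Rn n) (Rn n))).trans
    (mul_le_of_le_one_right (norm_nonneg _) (Finset.prod_le_one (fun _ _ => norm_nonneg _)
      (fun _ _ => ContinuousLinearMap.norm_inr_le_one ℝ (Rn n) (Rn n))))
  have h2 := hD c (C * ((2 : ℝ) ^ m)⁻¹) hcs (fun j hj p => by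
    rw [← div_eq_mul_inv, le_div_iff₀ (by positivity), mul_comm]
    exact hC j hj (m, p)) (x, ζ)
  rw [← mul_assoc] at h2
  refine le_trans ?_ h2
  gcongr
  simp

/-- A tempered distribution is controlled by finitely many Schwartz seminorms. Summing their bounds
gives a `g` of polynomial growth that does not depend on `m`. -/
theorem IsSmoothing.exists_norm_opFun_sub_le {n : ℕ} {b : Rn n → Rn n → ℂ} (hb : IsSmoothing b)
    (ψ : Modulation n) (u : 𝓢'(Rn n, ℂ)) : ∃ g : Rn n → ℝ, Continuous g ∧ ∀ (m : ℕ) (x : Rn n),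
      ‖opFun (isSmoothing_modulate ψ m hb.exists_isSymbol) u x - opFun hb u x‖
        ≤ ((2 : ℝ) ^ m)⁻¹ * g x := by
  set q : Seminorm ℂ 𝓢(Rn n, ℂ) := (normSeminorm ℂ ℂ).comp (𝓕 u).toLinearMap
  have hq : Continuous q := by
    change Continuous fun f : 𝓢(Rn n, ℂ) => ‖(𝓕 u) f‖
    exact (𝓕 u).continuous.norm
  obtain ⟨s, A, -, hA⟩ := Seminorm.bound_of_continuous (schwartz_withSeminorms ℂ (Rn n) ℂ) q hq
  choose C M hC0 hC using hb.exists_seminorm_phaseSchwartz_sub_le ψ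
  refine ⟨fun x => A * ∑ i ∈ s, C i.1 i.2 * (1 + ‖x‖) ^ M i.1 i.2, by fun_prop, fun m x => ?_⟩
  set f : 𝓢(Rn n, ℂ) :=
    phaseSchwartz (isSmoothing_modulate ψ m hb.exists_isSymbol) x - phaseSchwartz hb x
  have e : opFun (isSmoothing_modulate ψ m hb.exists_isSymbol) u x - opFun hb u x = (𝓕 u) f :=
    (map_sub (𝓕 u) _ _).symm
  rw [e]
  refine (hA f).trans ?_
  change (A : ℝ) * (s.sup (schwartzSeminormFamily ℂ (Rn n) ℂ)) f ≤ _
  rw [mul_left_comm]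
  refine mul_le_mul_of_nonneg_left ?_ A.2
  rw [Finset.mul_sum]
  refine Seminorm.finset_sup_apply_le (Finset.sum_nonneg fun i _ => ?_) fun i hi => ?_
  · have := hC0 i.1 i.2
    positivity
  · have h1 := hC i.1 i.2 m x
    refine (h1.trans_eq ?_).trans (Finset.single_le_sum
      (f := fun i : ℕ × ℕ => ((2 : ℝ) ^ m)⁻¹ * (C i.1 i.2 * (1 + ‖x‖) ^ M i.1 i.2))
      (fun i _ => ?_) hi)
    · ring
    · have := hC0 i.1 i.2
      positivity

/-- For `b ∈ S^{-∞}` the operators of the modulated symbols converge to `OP(b)`. -/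
theorem IsSmoothing.tendstoDist_OP_modulate {n : ℕ} {b : Rn n → Rn n → ℂ} (hb : IsSmoothing b)
    (ψ : Modulation n) (u : 𝓢'(Rn n, ℂ)) :
    TendstoDist (fun m => OP (isSmoothing_modulate ψ m hb.exists_isSymbol) u) (OP hb u) := by
  intro φ
  obtain ⟨g, hg, hgb⟩ := hb.exists_norm_opFun_sub_le ψ u
  have hi : ∀ {c : Rn n → Rn n → ℂ} (hc : IsSmoothing c),
      Integrable (fun x => φ x • opFun hc u x) := fun hc =>
    TestFunction.integrable_bilin (ContinuousLinearMap.lsmul ℝ ℝ : ℝ →L[ℝ] ℂ →L[ℝ] ℂ)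
      ((continuous_opFun hc u).locallyIntegrable.locallyIntegrableOn _) φ
  -- The growth of `g` is harmless since `φ` has compact support.
  have hig : Integrable (fun x => φ x * g x) :=
    TestFunction.integrable_bilin (ContinuousLinearMap.lsmul ℝ ℝ : ℝ →L[ℝ] ℝ →L[ℝ] ℝ)
      (hg.locallyIntegrable.locallyIntegrableOn _) φ
  rw [tendsto_iff_norm_sub_tendsto_zero]
  have hlim : Tendsto (fun m : ℕ => ((2 : ℝ) ^ m)⁻¹ * ∫ x, ‖φ x * g x‖) atTop (𝓝 0) := by
    have h := (tendsto_pow_atTop_nhds_zero_of_lt_one (r := (2 : ℝ)⁻¹) (by norm_num)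
      (by norm_num)).mul_const (∫ x, ‖φ x * g x‖)
    simpa only [inv_pow, zero_mul] using h
  refine squeeze_zero (fun _ => norm_nonneg _) (fun m => ?_) hlim
  change ‖distOfFun _ φ - distOfFun _ φ‖ ≤ _
  rw [distOfFun_apply (continuous_opFun _ u), distOfFun_apply (continuous_opFun _ u),
    ← integral_sub (hi _) (hi _), ← integral_const_mul]
  refine norm_integral_le_of_norm_le (hig.norm.const_mul _) (Eventually.of_forall fun x => ?_)
  rw [← smul_sub, norm_smul, norm_mul, mul_left_comm]
  refine mul_le_mul_of_nonneg_left ((hgb m x).trans ?_) (norm_nonneg _)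
  gcongr
  exact Real.le_norm_self _

/-! ### The operator assignment -/

/-- The value of `vfmOp` is picked by choice; uniqueness of limits in `𝓓'` identifies it with any
limit already known. -/
theorem IsVFMLimit.exists_vfmOp_eq {n : ℕ} {a : SymbolOneOne n} {u : 𝓢'(Rn n, ℂ)} {T : Dist n}
    (h : IsVFMLimit a u T) : ∃ hu : u ∈ (vfmOp a).domain, vfmOp a ⟨u, hu⟩ = T :=
  ⟨⟨T, h⟩, (Exists.choose_spec (⟨T, h⟩ : ∃ T, IsVFMLimit a u T)).unique h⟩

theorem isVFMLimit_vfmOp {n : ℕ} (a : SymbolOneOne n) (u : (vfmOp a).domain) :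
    IsVFMLimit a u (vfmOp a u) :=
  u.2.choose_spec

/-- `OP(b)u` is the limit for every `ψ` and every `u`, which settles existence, independence of `ψ`
and the value at once. -/
theorem isCompatible_vfmOp (n : ℕ) : IsCompatible (n := n) vfmOp := fun _ hb u =>
  IsVFMLimit.exists_vfmOp_eq fun ψ => hb.tendstoDist_OP_modulate ψ u

/-- Modulated symbols are in `S^{-∞}`, where compatibility replaces `vfmOp` by `OP`; what remains is
the definition of the limit. -/
theorem isStable_vfmOp (n : ℕ) : IsStable (n := n) vfmOp := by
  intro b ψ u
  choose hu h using fun m => isCompatible_vfmOp n (b.modulate ψ m)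
    (isSmoothing_modulate ψ m b.2) u
  refine ⟨hu, ?_⟩
  simp only [h]
  exact isVFMLimit_vfmOp b u ψ

/-- Compatibility turns the sequence in the stability axiom into `OP(a_{ψ,m})u`. Its limit `A a u`
does not involve `ψ`, so the independence of `ψ` required by `vfmOp` is automatic. -/
theorem le_vfmOp {n : ℕ} {A : SymbolOneOne n → (𝓢'(Rn n, ℂ) →ₗ.[ℂ] Dist n)}
    (hc : IsCompatible A) (hs : IsStable A) (a : SymbolOneOne n) : A a ≤ vfmOp a := by
  have h : ∀ u : (A a).domain, IsVFMLimit a u (A a u) := by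
    intro u ψ
    obtain ⟨hu, hlim⟩ := hs a ψ u
    have e : ∀ m, A (a.modulate ψ m) ⟨u, hu m⟩ = OP (isSmoothing_modulate ψ m a.2) u :=
      fun m => (hc (a.modulate ψ m) (isSmoothing_modulate ψ m a.2) u).choose_spec
    simpa only [e] using hlim
  refine ⟨fun u hu => ⟨_, h ⟨u, hu⟩⟩, fun u v huv => ?_⟩
  refine (h u).unique ?_
  rw [huv]
  exact isVFMLimit_vfmOp a v

end

end TypeOneOne

theorem mainTheorem2 (n : ℕ) :
    (TypeOneOne.IsCompatible (n := n) TypeOneOne.vfmOp ∧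
      TypeOneOne.IsStable (n := n) TypeOneOne.vfmOp) ∧
    ∀ A : TypeOneOne.SymbolOneOne n → (𝓢'(TypeOneOne.Rn n, ℂ) →ₗ.[ℂ] TypeOneOne.Dist n),
      TypeOneOne.IsCompatible A → TypeOneOne.IsStable A →
        ∀ a : TypeOneOne.SymbolOneOne n, A a ≤ TypeOneOne.vfmOp a :=
  ⟨⟨TypeOneOne.isCompatible_vfmOp n, TypeOneOne.isStable_vfmOp n⟩,
    fun _ hc hs a => TypeOneOne.le_vfmOp hc hs a⟩
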